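/- Let $G$ be a finite group and let $D(G)$ be its Drinfel'd double over $\mathbb{C}$: the Hopf algebra with basis $e_g\# h$ ($g,h\in G$), product $(e_a\# h)(e_b\# k)=\delta_{a,\,hbh^{-1}}\,e_a\# hk$, unit $\sum_g e_g\#1$, coproduct $\Delta(e_g\# h)=\sum_{ab=g}(e_a\# h)\otimes(e_b\# h)$, counit $\varepsilon(e_g\# h)=\delta_{g,1}$ and antipode $S(e_g\# h)=e_{h^{-1}g^{-1}h}\# h^{-1}$. Let $\Lambda$ be the normalized integral of $D(G)$ (that is, $x\Lambda=\varepsilon(x)\Lambda$ for all $x$, and $\varepsilon(\Lambda)=1$), and for $x\in D(G)$ and $n\ge 1$ let $x^{[n]}=x_1x_2\cdots x_n$ be the Sweedler power. The $n$-th Frobenius–Schur indicator of a finite-dimensional representation of $D(G)$ with character $\chi$ is $\nu_n(\chi)=\chi(\Lambda^{[n]})$. For a finite group $K$, let $I(K)$ be the set of its irreducible complex characters, $R(K)$ the group of virtual characters ($\mathbb{Z}$-linear combinations of elements of $I(K)$), and $\langle\varphi,\psi\rangle_K=|K|^{-1}\sum_{x\in K}\varphi(x)\overline{\psi(x)}$.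 Two elements $g,h\in K$ lie in the same rational conjugacy class of $K$ if $h$ is conjugate in $K$ to $g^m$ for some $m$ with $\gcd(m,|K|)=1$. Fix $u\in G$ with centralizer $C=C_G(u)$. For $\eta\in I(C)$ afforded by the irreducible representation $W$ of $C$, let $\chi_\eta$ be the character of the $D(G)$-module $\mathbb{C}G\otimes_{\mathbb{C}C}W$, on which $e_g\# h$ acts by $(e_g\# h)(x\otimes w)=\delta_{g,\,hxu(hx)^{-1}}\,hx\otimes w$ for $x \in G$, $w \in W$. Let $n$ be a positive integer, and for $g\in G$ put $G_n(u,g)=\{a\in G : (au^{-1})^n=a^n=g\}$; define $\zeta_n:C\to\mathbb{Z}$ by $\zeta_n(g)=|G_n(u,g)|$. Then the following are equivalent: 1. $\nu_n(\chi_\eta)\in\mathbb{Z}$ for each $\eta\in I(C)$; 2. $\zeta_n\in R(C)$; 3. $\langle \mathrm{Res}^C_H\,\zeta_n,\lambda\rangle_H\in\mathbb{Q}$ for each cyclic subgroup $H\subseteq C$ and each $\lambda\in I(H)$; 4. $\zeta_n$ is constant on the rational conjugacy classes of $C$. -/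

import Mathlib

open scoped TensorProduct

noncomputable section

/-! ### Integrals, Sweedler powers and indicators for Hopf algebras -/

/-- `Λ` is a normalized (left) integral: `h Λ = ε(h) Λ` for all `h`, and `ε(Λ) = 1`. -/
def IsNormalizedIntegral {H : Type*} [Ring H] [HopfAlgebra ℂ H] (Λ : H) : Prop :=
  (∀ h : H, h * Λ = (Coalgebra.counit (R := ℂ) h) • Λ) ∧ Coalgebra.counit (R := ℂ) Λ = 1

/-- The Sweedler power `h^{[n]} = h₁ h₂ ⋯ hₙ`: the `n`-th convolution power of the identity map of
`H`, evaluated at `h`. -/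
def sweedlerPower {H : Type*} [Ring H] [HopfAlgebra ℂ H] (n : ℕ) (h : H) : H :=
  ((WithConv.toConv (LinearMap.id : H →ₗ[ℂ] H)) ^ n).ofConv h

/-- The `n`-th Frobenius–Schur indicator `χ(Λ^{[n]})` of a representation `ρ` of a Hopf algebra,
where `χ` is the character (trace function) of `ρ` and `Λ` is the normalized integral. -/
def hopfIndicator {H : Type*} [Ring H] [HopfAlgebra ℂ H] (Λ : H) (n : ℕ)
    {V : Type*} [AddCommGroup V] [Module ℂ V] (ρ : H →ₐ[ℂ] Module.End ℂ V) : ℂ :=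
  LinearMap.trace ℂ V (ρ (sweedlerPower n Λ))

/-! ### The Drinfel'd double of a finite group -/

/-- The Drinfel'd double `D(G) = ℂ^G ⋊ ℂG`. The element `f` stands for
`∑ f (g, h) • (e_g # h)`, with `e_g` the indicator function of `g`. -/
def DrinfeldDouble (G : Type*) : Type _ := G × G → ℂ

namespace DrinfeldDouble

variable {G : Type*}

instance instAddCommGroup : AddCommGroup (DrinfeldDouble G) := inferInstanceAs (AddCommGroup (G × G → ℂ))

instance : Module ℂ (DrinfeldDouble G) := inferInstanceAs (Module ℂ (G × G → ℂ))

theorem add_apply (x y : DrinfeldDouble G) (p : G × G) : (x + y) p = x p + y p := rfl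

theorem smul_apply (c : ℂ) (x : DrinfeldDouble G) (p : G × G) : (c • x) p = c * x p := rfl

theorem zero_apply (p : G × G) : (0 : DrinfeldDouble G) p = 0 := rfl

/-- The coordinate functional at `p`. -/
def coord (p : G × G) : DrinfeldDouble G →ₗ[ℂ] ℂ where
  toFun x := x p
  map_add' _ _ := rfl
  map_smul' _ _ := rfl

theorem coord_apply (p : G × G) (x : DrinfeldDouble G) : coord p x = x p := rfl

theorem coord_ext {x y : DrinfeldDouble G} (H : ∀ p, coord p x = coord p y) : x = y :=
  funext H

/-- The basis element `e_g # h`. -/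
def e [DecidableEq G] (g h : G) : DrinfeldDouble G :=
  (Pi.single (g, h) (1 : ℂ) : G × G → ℂ)

theorem e_apply [DecidableEq G] (g h : G) (p : G × G) :
    e g h p = if p.1 = g ∧ p.2 = h then 1 else 0 := by
  rw [e, Pi.single_apply]
  simp only [Prod.ext_iff]

variable [Fintype G] [DecidableEq G]

theorem eq_sum (x : DrinfeldDouble G) : x = ∑ g, ∑ h, x (g, h) • e g h := by
  refine coord_ext fun p => ?_
  obtain ⟨a, b⟩ := p
  simp only [map_sum, map_smul, coord_apply, e_apply, smul_eq_mul]
  rw [Finset.sum_eq_single a, Finset.sum_eq_single b]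
  · simp
  · intro c _ hc; simp [hc.symm]
  · simp
  · intro c _ hc; simp [hc.symm]
  · simp

theorem induction {P : DrinfeldDouble G → Prop} (x : DrinfeldDouble G)
    (h0 : P 0) (hadd : ∀ x y, P x → P y → P (x + y)) (hsmul : ∀ (c : ℂ) x, P x → P (c • x))
    (he : ∀ g h, P (e g h)) : P x := by
  rw [eq_sum x]
  exact Finset.sum_induction _ P hadd h0 fun g _ =>
    Finset.sum_induction _ P hadd h0 fun h _ => hsmul _ _ (he g h)

theorem hom_ext {M : Type*} [AddCommGroup M] [Module ℂ M] {f f' : DrinfeldDouble G →ₗ[ℂ] M}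
    (H : ∀ g h, f (e g h) = f' (e g h)) : f = f' := by
  ext x
  rw [eq_sum x]
  simp [H]

/-- The linear map out of `D(G)` with prescribed values on the basis `e_g # h`. -/
def lin {M : Type*} [AddCommGroup M] [Module ℂ M] (F : G → G → M) : DrinfeldDouble G →ₗ[ℂ] M :=
  ∑ g, ∑ h, (coord (g, h)).smulRight (F g h)

theorem lin_e {M : Type*} [AddCommGroup M] [Module ℂ M] (F : G → G → M) (g h : G) :
    lin F (e g h) = F g h := by
  simp only [lin, LinearMap.sum_apply, LinearMap.smulRight_apply, coord_apply, e_apply]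
  rw [Finset.sum_eq_single g, Finset.sum_eq_single h]
  · simp
  · intro c _ hc; simp [hc]
  · simp
  · intro c _ hc; simp [hc]
  · simp

variable [Group G]

/-- The multiplication as a bilinear map:
`(e_a # h) (e_b # k) = δ_{a, h b h⁻¹} e_a # (h k)`. -/
def mulLin : DrinfeldDouble G →ₗ[ℂ] DrinfeldDouble G →ₗ[ℂ] DrinfeldDouble G :=
  lin fun a h => lin fun b k => if a = h * b * h⁻¹ then e a (h * k) else 0

instance : Mul (DrinfeldDouble G) := ⟨fun x y => mulLin x y⟩

instance : One (DrinfeldDouble G) := ⟨∑ g, e g 1⟩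

theorem mul_def (x y : DrinfeldDouble G) : x * y = mulLin x y := rfl

theorem one_def : (1 : DrinfeldDouble G) = ∑ g, e g 1 := rfl

theorem e_mul_e (a h b k : G) :
    (e a h * e b k : DrinfeldDouble G) = if a = h * b * h⁻¹ then e a (h * k) else 0 := by
  rw [mul_def, mulLin, lin_e, lin_e]

theorem mulLin_e (a h b k : G) :
    mulLin (e a h) (e b k) = if a = h * b * h⁻¹ then e a (h * k) else 0 := e_mul_e a h b k

theorem mulLin_assoc (x y z : DrinfeldDouble G) :
    mulLin (mulLin x y) z = mulLin x (mulLin y z) := by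
  induction x using induction with
  | h0 => simp
  | hadd x x' hx hx' => simp [hx, hx']
  | hsmul c x hx => simp [hx]
  | he a h =>
  induction y using induction with
  | h0 => simp
  | hadd x x' hx hx' => simp [hx, hx']
  | hsmul c x hx => simp [hx]
  | he b k =>
  induction z using induction with
  | h0 => simp
  | hadd x x' hx hx' => simp [hx, hx']
  | hsmul c x hx => simp [hx]
  | he c l =>
  have hk : h * (k * c * k⁻¹) * h⁻¹ = h * k * c * (h * k)⁻¹ := by group
  by_cases h2 : b = k * c * k⁻¹
  · subst h2
    by_cases h1 : a = h * (k * c * k⁻¹) * h⁻¹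
    · rw [mulLin_e, if_pos h1, mulLin_e, if_pos (h1.trans hk), mulLin_e, if_pos rfl, mulLin_e,
        if_pos h1, mul_assoc]
    · rw [mulLin_e, if_neg h1, mulLin_e, if_pos rfl, mulLin_e, if_neg h1, map_zero,
        LinearMap.zero_apply]
  · rw [mulLin_e b, if_neg h2, map_zero, mulLin_e]
    split_ifs with h1
    · rw [mulLin_e, if_neg]
      intro h3
      exact h2 (mul_left_cancel (mul_right_cancel (h1.symm.trans (h3.trans hk.symm))))
    · simp

instance : Ring (DrinfeldDouble G) where
  __ := (instAddCommGroup : AddCommGroup (DrinfeldDouble G))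
  left_distrib x y z := by simp [mul_def]
  right_distrib x y z := by simp [mul_def]
  zero_mul x := by simp [mul_def]
  mul_zero x := by simp [mul_def]
  mul_assoc x y z := mulLin_assoc x y z
  one_mul x := by
    rw [mul_def, one_def]
    induction x using induction with
    | h0 => simp
    | hadd x x' hx hx' => rw [map_add, hx, hx']
    | hsmul c x hx => rw [map_smul, hx]
    | he a h => simp [mulLin_e]
  mul_one x := by
    rw [mul_def, one_def]
    induction x using induction with
    | h0 => simp
    | hadd x x' hx hx' => rw [map_add, LinearMap.add_apply, hx, hx']
    | hsmul c x hx => rw [map_smul, LinearMap.smul_apply, hx]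
    | he a h =>
      rw [map_sum, Finset.sum_eq_single (h⁻¹ * a * h)]
      · simp [mulLin_e, mul_assoc]
      · intro b _ hb
        rw [mulLin_e, if_neg]
        rintro rfl
        apply hb
        group
      · simp

instance : Algebra ℂ (DrinfeldDouble G) :=
  Algebra.ofModule (fun c x y => by simp [mul_def]) (fun c x y => by simp [mul_def])

/-- `ε(e_g # h) = δ_{g,1}`. -/
def counitLin : DrinfeldDouble G →ₗ[ℂ] ℂ := lin fun g _ => if g = 1 then 1 else 0

/-- `Δ(e_g # h) = ∑_{ab = g} (e_a # h) ⊗ (e_b # h)`. -/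
def comulLin : DrinfeldDouble G →ₗ[ℂ] DrinfeldDouble G ⊗[ℂ] DrinfeldDouble G :=
  lin fun g h => ∑ a, e a h ⊗ₜ[ℂ] e (a⁻¹ * g) h

/-- `S(e_g # h) = e_{h⁻¹ g⁻¹ h} # h⁻¹`. -/
def antipodeLin : DrinfeldDouble G →ₗ[ℂ] DrinfeldDouble G :=
  lin fun g h => e (h⁻¹ * g⁻¹ * h) h⁻¹

theorem counitLin_e (g h : G) : counitLin (e g h) = if g = 1 then 1 else 0 := lin_e _ g h

theorem comulLin_e (g h : G) :
    comulLin (e g h) = ∑ a, e a h ⊗ₜ[ℂ] e (a⁻¹ * g) h := lin_e _ g h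

theorem antipodeLin_e (g h : G) : antipodeLin (e g h) = e (h⁻¹ * g⁻¹ * h) h⁻¹ := lin_e _ g h

instance : CoalgebraStruct ℂ (DrinfeldDouble G) where
  comul := comulLin
  counit := counitLin

theorem comul_e (g h : G) :
    Coalgebra.comul (R := ℂ) (e g h) = ∑ a, e a h ⊗ₜ[ℂ] e (a⁻¹ * g) h := comulLin_e g h

theorem counit_e (g h : G) :
    Coalgebra.counit (R := ℂ) (e g h) = if g = 1 then 1 else 0 := counitLin_e g h

instance : Coalgebra ℂ (DrinfeldDouble G) where
  coassoc := by
    refine hom_ext fun g h => ?_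
    simp only [LinearMap.comp_apply, comul_e, map_sum, LinearMap.rTensor_tmul,
      LinearMap.lTensor_tmul, TensorProduct.sum_tmul, TensorProduct.tmul_sum,
      LinearEquiv.coe_coe, TensorProduct.assoc_tmul]
    rw [Finset.sum_comm]
    refine Finset.sum_congr rfl fun a _ => ?_
    refine Fintype.sum_equiv (Equiv.mulLeft a⁻¹) _ _ fun b => ?_
    simp [mul_assoc]
  rTensor_counit_comp_comul := by
    refine hom_ext fun g h => ?_
    simp [LinearMap.comp_apply, comul_e, counit_e, TensorProduct.ite_tmul]
  lTensor_counit_comp_comul := by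
    refine hom_ext fun g h => ?_
    simp [LinearMap.comp_apply, comul_e, counit_e, TensorProduct.tmul_ite, inv_mul_eq_one]

theorem counit_mul' (x y : DrinfeldDouble G) :
    Coalgebra.counit (R := ℂ) (x * y) =
      Coalgebra.counit (R := ℂ) x * Coalgebra.counit (R := ℂ) y := by
  induction x using induction with
  | h0 => simp
  | hadd x x' hx hx' => simp [add_mul, hx, hx']
  | hsmul c x hx => simp [hx, mul_assoc]
  | he a h =>
  induction y using induction with
  | h0 => simp
  | hadd x x' hx hx' => simp [mul_add, hx, hx']
  | hsmul c x hx => simp [hx]; ring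
  | he b k =>
  rw [e_mul_e, counit_e, counit_e]
  by_cases hb : b = 1
  · subst hb
    by_cases ha : a = 1 <;> simp [ha, counit_e]
  · by_cases ha : a = 1
    · subst ha
      have : ¬ (1 : G) = h * b * h⁻¹ := by
        intro h1
        exact hb (conj_eq_one_iff.mp h1.symm)
      simp [this, hb]
    · split_ifs <;> simp [counit_e, ha]

theorem comul_mul' (x y : DrinfeldDouble G) :
    Coalgebra.comul (R := ℂ) (x * y) =
      Coalgebra.comul (R := ℂ) x * Coalgebra.comul (R := ℂ) y := by
  induction x using induction with
  | h0 => simp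
  | hadd x x' hx hx' => simp [add_mul, hx, hx']
  | hsmul c x hx =>
    rw [smul_mul_assoc, map_smul, hx, map_smul]
    exact (Algebra.smul_mul_assoc c _ _).symm
  | he a h =>
  induction y using induction with
  | h0 => simp
  | hadd x x' hx hx' => simp [mul_add, hx, hx']
  | hsmul c x hx =>
    rw [mul_smul_comm, map_smul, hx, map_smul]
    exact (Algebra.mul_smul_comm c _ _).symm
  | he b k =>
  rw [e_mul_e, comul_e, comul_e, Finset.sum_mul_sum]
  have key : ∀ c : G, ∑ d : G, (e c h ⊗ₜ[ℂ] e (c⁻¹ * a) h) * (e d k ⊗ₜ[ℂ] e (d⁻¹ * b) k) =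
      if a = h * b * h⁻¹ then e c (h * k) ⊗ₜ[ℂ] e (c⁻¹ * a) (h * k) else 0 := by
    intro c
    rw [Finset.sum_eq_single (h⁻¹ * c * h)]
    · rw [Algebra.TensorProduct.tmul_mul_tmul, e_mul_e, e_mul_e]
      have h1 : c = h * (h⁻¹ * c * h) * h⁻¹ := by group
      have h2 : (c⁻¹ * a = h * ((h⁻¹ * c * h)⁻¹ * b) * h⁻¹) ↔ a = h * b * h⁻¹ := by
        have : h * ((h⁻¹ * c * h)⁻¹ * b) * h⁻¹ = c⁻¹ * (h * b * h⁻¹) := by group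
        rw [this, mul_right_inj]
      rw [if_pos h1]
      simp only [h2]
      split_ifs <;> simp
    · intro d _ hd
      rw [Algebra.TensorProduct.tmul_mul_tmul, e_mul_e, if_neg, TensorProduct.zero_tmul]
      rintro rfl
      apply hd
      group
    · simp
  simp only [key]
  split_ifs
  · rw [comul_e]
  · simp

instance : Bialgebra ℂ (DrinfeldDouble G) :=
  Bialgebra.mk' ℂ (DrinfeldDouble G)
    (by rw [one_def, map_sum]; simp [counit_e])
    (fun {x y} => counit_mul' x y)
    (by
      rw [one_def, map_sum, Algebra.TensorProduct.one_def, one_def, TensorProduct.sum_tmul]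
      simp only [comul_e, TensorProduct.tmul_sum]
      rw [Finset.sum_comm]
      refine Finset.sum_congr rfl fun a _ => ?_
      exact Fintype.sum_equiv (Equiv.mulLeft a⁻¹) _ _ fun b => by simp)
    (fun {x y} => comul_mul' x y)

instance : HopfAlgebra ℂ (DrinfeldDouble G) where
  antipode := antipodeLin
  mul_antipode_rTensor_comul := by
    refine hom_ext fun g h => ?_
    simp only [LinearMap.comp_apply, comul_e, map_sum, LinearMap.rTensor_tmul, antipodeLin_e,
      LinearMap.mul'_apply, e_mul_e, counit_e, Algebra.linearMap_apply]
    have h1 : ∀ a : G, (h⁻¹ * a⁻¹ * h = h⁻¹ * (a⁻¹ * g) * h⁻¹⁻¹) ↔ g = 1 := by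
      intro a
      rw [inv_inv, mul_left_inj, mul_right_inj]
      simp
    simp only [h1, inv_mul_cancel]
    split_ifs
    · rw [map_one, one_def]
      exact Fintype.sum_equiv ((Equiv.inv G).trans (MulAut.conj h⁻¹).toEquiv) _ _
        fun a => by simp
    · simp
  mul_antipode_lTensor_comul := by
    refine hom_ext fun g h => ?_
    simp only [LinearMap.comp_apply, comul_e, map_sum, LinearMap.lTensor_tmul, antipodeLin_e,
      LinearMap.mul'_apply, e_mul_e, counit_e, Algebra.linearMap_apply]
    have h1 : ∀ a : G, (a = h * (h⁻¹ * (a⁻¹ * g)⁻¹ * h) * h⁻¹) ↔ g = 1 := by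
      intro a
      have : h * (h⁻¹ * (a⁻¹ * g)⁻¹ * h) * h⁻¹ = g⁻¹ * a := by group
      rw [this]
      simp
    simp only [h1, mul_inv_cancel]
    split_ifs
    · rw [map_one, one_def]
    · simp

/-- `D(G)` has a normalized integral, namely `|G|⁻¹ ∑_h e_1 # h`. -/
theorem exists_isNormalizedIntegral : ∃ Λ : DrinfeldDouble G, IsNormalizedIntegral Λ := by
  refine ⟨(Fintype.card G : ℂ)⁻¹ • ∑ h, e 1 h, fun x => ?_, ?_⟩
  · induction x using induction with
    | h0 => simp
    | hadd x x' hx hx' => rw [add_mul, hx, hx', map_add, add_smul]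
    | hsmul c x hx => rw [smul_mul_assoc, hx, map_smul, smul_assoc]
    | he a k =>
      rw [mul_smul_comm, Finset.mul_sum, smul_comm, counit_e]
      congr 1
      simp only [e_mul_e, mul_one, mul_inv_cancel]
      split_ifs with ha
      · subst ha
        rw [one_smul]
        exact Fintype.sum_equiv (Equiv.mulLeft k) _ _ fun b => by simp
      · simp
  · have : (Fintype.card G : ℂ) ≠ 0 := by simp
    simp [counit_e, this]

end DrinfeldDouble

/-! ### The irreducible `D(G)`-modules attached to `(u, η)` -/

section Induced

variable {G : Type*} [Group G] [Fintype G] [DecidableEq G]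

/-- The centralizer `C(u)` of `u` in `G`. -/
abbrev centralizerOf (u : G) : Subgroup G := Subgroup.centralizer {u}

variable (u : G) {W : Type*} [AddCommGroup W] [Module ℂ W]
  (η : Representation ℂ (centralizerOf u) W)

/-- The induced module `ℂG ⊗_{ℂC(u)} W`. In Mathlib's model, the class `⟦x ⊗ w⟧` is the element
written `x⁻¹ ⊗ w` in `ℂG ⊗_{ℂC(u)} W`, and `h ∈ G` acts by `⟦x ⊗ w⟧ ↦ ⟦x h⁻¹ ⊗ w⟧`. -/
abbrev doubleModule : Type _ := Representation.IndV (centralizerOf u).subtype η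

open scoped MonoidAlgebra

/-- On `ℂ[G]`: keep those `x` with `x⁻¹ u x = g`, kill the others. -/
def degreeFilter (g : G) : ℂ[G] →ₗ[ℂ] ℂ[G] :=
  (MonoidAlgebra.basis G ℂ).constr ℂ fun x =>
    if x⁻¹ * u * x = g then MonoidAlgebra.single x 1 else 0

theorem degreeFilter_single (g x : G) :
    degreeFilter u g (MonoidAlgebra.single x 1) =
      if x⁻¹ * u * x = g then MonoidAlgebra.single x 1 else 0 := by
  have := (MonoidAlgebra.basis G ℂ).constr_basis ℂ (fun x =>
    if x⁻¹ * u * x = g then (MonoidAlgebra.single x 1 : ℂ[G]) else 0) x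
  simpa [degreeFilter] using this

/-- The action of `e_g ∈ ℂ^G` on the induced module: `e_g (y ⊗ w) = δ_{g, y u y⁻¹} y ⊗ w`,
where `y ⊗ w` is the class `⟦y⁻¹ ⊗ w⟧`. -/
def degreeProj (g : G) : Module.End ℂ (doubleModule u η) :=
  Representation.Coinvariants.map _ _ ⟨(degreeFilter u g).rTensor W, fun c => by
    ext x w
    have hc : c.1 * u = u * c.1 := Subgroup.mem_centralizer_singleton_iff.mp c.2
    have hx : (c.1 * x)⁻¹ * u * (c.1 * x) = x⁻¹ * u * x := by
      rw [mul_inv_rev, mul_assoc, mul_assoc, ← mul_assoc u, ← hc]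
      group
    have h1 := degreeFilter_single u g (c.1 * x)
    have h2 := degreeFilter_single u g x
    rw [hx] at h1
    by_cases h : x⁻¹ * u * x = g <;> simp [h1, h2, h]⟩

theorem degreeProj_mk (g x : G) (w : W) :
    degreeProj u η g (Representation.IndV.mk _ η x w) =
      if x⁻¹ * u * x = g then Representation.IndV.mk _ η x w else 0 := by
  have h2 := degreeFilter_single u g x
  by_cases h : x⁻¹ * u * x = g <;> simp [degreeProj, h2, h]

/-- The representation of `D(G)` on `ℂG ⊗_{ℂC(u)} W`: the element `e_g # h` acts as the action of
`h` followed by that of `e_g`. -/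
def doubleRep : DrinfeldDouble G →ₐ[ℂ] Module.End ℂ (doubleModule u η) :=
  AlgHom.ofLinearMap
    (DrinfeldDouble.lin fun g h =>
      degreeProj u η g * Representation.ind (centralizerOf u).subtype η h)
    (by
      rw [DrinfeldDouble.one_def, map_sum]
      simp only [DrinfeldDouble.lin_e, map_one, mul_one]
      refine Representation.IndV.hom_ext _ _ fun x => LinearMap.ext fun w => ?_
      simp only [LinearMap.comp_apply, LinearMap.sum_apply, Module.End.one_apply]
      refine Eq.trans (Finset.sum_congr rfl fun g _ => degreeProj_mk u η g x w) ?_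
      rw [Finset.sum_ite_eq]
      simp)
    (fun x y => by
      induction x using DrinfeldDouble.induction with
      | h0 => simp
      | hadd x x' hx hx' => simp only [add_mul, map_add, hx, hx']
      | hsmul c x hx => simp only [smul_mul_assoc, map_smul, hx]
      | he a h =>
      induction y using DrinfeldDouble.induction with
      | h0 => simp
      | hadd x x' hx hx' => simp only [mul_add, map_add, hx, hx']
      | hsmul c x hx => simp only [mul_smul_comm, map_smul, hx]
      | he b k =>
      rw [DrinfeldDouble.e_mul_e, apply_ite (DrinfeldDouble.lin _), map_zero]
      simp only [DrinfeldDouble.lin_e]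
      refine Representation.IndV.hom_ext _ _ fun x => LinearMap.ext fun w => ?_
      have hR : (degreeProj u η a * Representation.ind (centralizerOf u).subtype η h *
          (degreeProj u η b * Representation.ind (centralizerOf u).subtype η k))
            (Representation.IndV.mk _ η x w) =
          if a = h * b * h⁻¹ ∧ (x * (h * k)⁻¹)⁻¹ * u * (x * (h * k)⁻¹) = a then
            Representation.IndV.mk _ η (x * (h * k)⁻¹) w else 0 := by
        simp only [Module.End.mul_apply]
        rw [Representation.ind_mk, degreeProj_mk]
        have h0 : x * k⁻¹ * h⁻¹ = x * (h * k)⁻¹ := by group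
        have h1 : (x * (h * k)⁻¹)⁻¹ * u * (x * (h * k)⁻¹) =
          h * ((x * k⁻¹)⁻¹ * u * (x * k⁻¹)) * h⁻¹ := by group
        rw [h1]
        by_cases hb : (x * k⁻¹)⁻¹ * u * (x * k⁻¹) = b
        · rw [if_pos hb, Representation.ind_mk, degreeProj_mk, h0, h1, hb]
          simp [eq_comm]
        · rw [if_neg hb, map_zero, map_zero, if_neg]
          rintro ⟨h2, h3⟩
          exact hb (mul_left_cancel (mul_right_cancel (h3.trans h2)))
      refine Eq.trans ?_ hR.symm
      by_cases ha : a = h * b * h⁻¹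
      · rw [if_pos ha]
        simp only [ha, true_and]
        change degreeProj u η _ (Representation.ind _ η _ (Representation.IndV.mk _ η x w)) = _
        rw [Representation.ind_mk, degreeProj_mk]
      · simp [ha])

end Induced

/-! ### Characters, class functions and the function `ζ_n` -/

section Characters

/-- `I(G)`: the irreducible complex characters of `G`. (Every finite-dimensional representation is
isomorphic to one on some `ℂ^d`, so it is enough to let the carrier range over `Type`.) -/
def irrChars (G : Type*) [Group G] : Set (G → ℂ) :=
  {χ | ∃ (W : Type) (_ : AddCommGroup W) (_ : Module ℂ W) (_ : FiniteDimensional ℂ W)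
    (ρ : Representation ℂ G W), ρ.IsIrreducible ∧ χ = ρ.character}

/-- `R(G)`: the virtual characters, i.e. the `ℤ`-linear combinations of irreducible characters. -/
def virtualChars (G : Type*) [Group G] : AddSubgroup (G → ℂ) :=
  AddSubgroup.closure (irrChars G)

/-- `⟨φ, ψ⟩_G = |G|⁻¹ ∑_g φ(g) conj(ψ(g))`, for a finite group `G`. -/
def cfInner {G : Type*} [Group G] [Finite G] (φ ψ : G → ℂ) : ℂ :=
  (Nat.card G : ℂ)⁻¹ * ∑ᶠ g : G, φ g * (starRingEnd ℂ) (ψ g)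

/-- `g` and `h` lie in the same rational conjugacy class of the finite group `G`: `h` is conjugate
to a power `g ^ m` with `m` prime to `|G|`. -/
def RationallyConj {G : Type*} [Group G] [Finite G] (g h : G) : Prop :=
  ∃ m : ℕ, m.Coprime (Nat.card G) ∧ IsConj (g ^ m) h

/-- `G_n(u, g) = {a ∈ G | (a u⁻¹)^n = a^n = g}`. -/
def rootSet {G : Type*} [Group G] (n : ℕ) (u g : G) : Set G :=
  {a | (a * u⁻¹) ^ n = a ^ n ∧ a ^ n = g}

/-- `ζ_n : C(u) → ℤ ⊆ ℂ`, `g ↦ |G_n(u, g)|`. -/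
def zetaFun {G : Type*} [Group G] (n : ℕ) (u : G) (g : centralizerOf u) : ℂ :=
  ((rootSet n u (g : G)).ncard : ℂ)

end Characters

end

/-!
Taking the trace of the closed form of `Λ^{[n]}` on the induced module, which is the module of
coinvariants of `C(u)` in `ℂG ⊗ W`, gives `ν_n(χ_η) = ⟨η, ζ_n⟩`. These numbers are algebraic
integers: `ν_n` is the trace of the idempotent by which `Λ` acts on the `n`-th tensor power,
composed with the cyclic shift, which commutes with it and has finite order. So they are integers as
soon as they are rational, and `ν_n(χ_η) ∈ ℤ` for all `η` says that `ζ_n` is a virtual character.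

Rationality is a matter of the Galois action on roots of unity, which turns the value of a character
at `g` into its value at `g ^ m`: a rational class function constant on rational classes has
rational multiplicities, and a rational combination of characters with rational values is constant
on rational classes. The latter, applied to the subgroups generated by one element, recovers the
rational classes from the cyclic subgroups.
-/

section RootsOfUnity

open Polynomial

variable {L : Type*} [Field L] [CharZero L] {N : ℕ} [NeZero N] {ω : L} {p : ℚ[X]}

theorem aeval_pow_eq_of_aeval_eq_rat (hω : IsPrimitiveRoot ω N) {m : ℕ} (hm : m.Coprime N) {q : ℚ}
    (h : aeval ω p = (q : L)) : aeval (ω ^ m) p = (q : L) := by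
  have hroot : aeval ω (p - C q) = 0 := by simp [h]
  have hdvd := minpoly.dvd ℚ ω hroot
  rw [← cyclotomic_eq_minpoly_rat hω (NeZero.pos N),
    cyclotomic_eq_minpoly_rat (hω.pow_of_coprime m hm) (NeZero.pos N)] at hdvd
  simpa [sub_eq_zero] using minpoly.dvd_iff.1 hdvd

theorem aeval_modByMonic_cyclotomic (hω : IsPrimitiveRoot ω N) (p : ℚ[X]) :
    aeval ω (p %ₘ cyclotomic N ℚ) = aeval ω p :=
  aeval_modByMonic_eq_self_of_root <| by
    rw [aeval_def, ← eval_map, map_cyclotomic]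
    exact hω.isRoot_cyclotomic (NeZero.pos N)

/-- Modulo the cyclotomic polynomial, `p` has degree less than the number of primitive roots, so it
is constant as soon as its values at the primitive roots agree. -/
theorem exists_rat_of_aeval_pow_eq (hω : IsPrimitiveRoot ω N)
    (h : ∀ m : ℕ, m.Coprime N → aeval (ω ^ m) p = aeval ω p) : ∃ q : ℚ, aeval ω p = (q : L) := by
  set r := p %ₘ cyclotomic N ℚ
  have hdeg : (r.map (algebraMap ℚ L)).degree < (primitiveRoots N L).card := by
    rw [degree_map, hω.card_primitiveRoots, ← degree_cyclotomic N ℚ]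
    exact degree_modByMonic_lt p (cyclotomic.monic N ℚ)
  have hconst : r.map (algebraMap ℚ L) = C (aeval ω p) := by
    have hpos : 0 < (primitiveRoots N L).card :=
      Finset.card_pos.2 ⟨ω, (mem_primitiveRoots (NeZero.pos N)).2 hω⟩
    refine eq_of_degrees_lt_of_eval_finset_eq _ hdeg
      (degree_C_le.trans_lt (by exact_mod_cast hpos)) fun ζ hζ => ?_
    have hζ := (mem_primitiveRoots (NeZero.pos N)).1 hζ
    obtain ⟨m, -, hm, rfl⟩ := hω.isPrimitiveRoot_iff.1 hζ
    rw [eval_C, eval_map_algebraMap, aeval_modByMonic_cyclotomic hζ, h m hm]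
  exact ⟨r.coeff 0, by simpa using (congrArg (coeff · 0) hconst).symm⟩

end RootsOfUnity

section PowersOfEndomorphism

open Module End

variable {K V : Type*} [Field K] [AddCommGroup V] [Module K V] {T : End K V}

theorem isSemisimple_of_pow_eq_one {N : ℕ} (hN : (N : K) ≠ 0) (hT : T ^ N = 1) :
    T.IsSemisimple :=
  isSemisimple_of_squarefree_aeval_eq_zero
    (Polynomial.X_pow_sub_one_separable_iff.2 hN).squarefree (by simp [hT])

theorem pow_eq_one_of_hasEigenvalue {N : ℕ} (hT : T ^ N = 1) {μ : K} (hμ : T.HasEigenvalue μ) :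
    μ ^ N = 1 := by
  obtain ⟨v, hv⟩ := hμ.exists_hasEigenvector
  have h := hv.pow_apply N
  rw [hT, one_apply] at h
  exact smul_left_injective K hv.2 (by simpa using h.symm)

variable [FiniteDimensional K V] [IsAlgClosed K]

theorem trace_pow_eq_sum_finrank_eigenspace (hT : T.IsSemisimple) (m : ℕ) :
    LinearMap.trace K V (T ^ m) =
      ∑ μ ∈ T.finite_hasEigenvalue.toFinset, (finrank K (T.eigenspace μ) : K) * μ ^ m := by
  classical
  have hinternal : DirectSum.IsInternal T.eigenspace :=
    DirectSum.isInternal_submodule_of_iSupIndep_of_iSup_eq_top T.eigenspaces_iSupIndep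
      hT.iSup_eigenspace_eq_top
  have hpow : ∀ μ, ∀ v ∈ T.eigenspace μ, (T ^ m) v = μ ^ m • v := by
    intro μ v hv
    rw [mem_eigenspace_iff] at hv
    induction m with
    | zero => simp
    | succ m ih => rw [pow_succ, mul_apply, hv, map_smul, ih, smul_smul, ← pow_succ']
  have hmaps : ∀ μ, Set.MapsTo (T ^ m) (T.eigenspace μ) (T.eigenspace μ) := fun μ v hv => by
    rw [SetLike.mem_coe, hpow μ v hv]
    exact Submodule.smul_mem _ _ hv
  rw [LinearMap.trace_eq_sum_trace_restrict' hinternal T.finite_hasEigenvalue hmaps]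
  refine Finset.sum_congr rfl fun μ _ => ?_
  have hrestrict : (T ^ m).restrict (hmaps μ) = μ ^ m • LinearMap.id :=
    LinearMap.ext fun v => Subtype.ext (hpow μ v v.2)
  rw [hrestrict, map_smul, LinearMap.trace_id, smul_eq_mul, mul_comm]

theorem exists_polynomial_trace_pow_eq_aeval [CharZero K] {N : ℕ} [NeZero N] {ω : K}
    (hω : IsPrimitiveRoot ω N) (hT : T ^ N = 1) :
    ∃ p : Polynomial ℚ, ∀ m : ℕ, LinearMap.trace K V (T ^ m) = Polynomial.aeval (ω ^ m) p := by
  have hroot : ∀ μ, T.HasEigenvalue μ → ∃ k, ω ^ k = μ := fun μ hμ =>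
    let ⟨k, _, hk⟩ := hω.eq_pow_of_pow_eq_one (pow_eq_one_of_hasEigenvalue hT hμ)
    ⟨k, hk⟩
  choose! k hk using hroot
  refine ⟨∑ μ ∈ T.finite_hasEigenvalue.toFinset,
    .C (finrank K (T.eigenspace μ) : ℚ) * .X ^ k μ, fun m => ?_⟩
  rw [trace_pow_eq_sum_finrank_eigenspace (isSemisimple_of_pow_eq_one (NeZero.ne _) hT), map_sum]
  refine Finset.sum_congr rfl fun μ hμ => ?_
  rw [Set.Finite.mem_toFinset] at hμ
  simp [← pow_mul, mul_comm m, pow_mul ω (k μ), hk μ hμ]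

end PowersOfEndomorphism

section CyclotomicFunctions

open Polynomial

variable {L : Type*} [Field L] [CharZero L]

/-- The `ℚ`-space of the functions `f` on a group `G` such that, for each `g`, the values
`f (g ^ m)` are those of a single rational polynomial at the points `ω ^ m`. When `ω` is a primitive
root of unity of order `|G|`, it contains the characters, and the Galois action on the values of `f`
corresponds to passing from `g` to `g ^ m`. -/
def cyclotomicFunctions (G : Type*) [Group G] (ω : L) : Submodule ℚ (G → L) where
  carrier := {f | ∀ g : G, ∃ p : ℚ[X], ∀ m : ℕ, f (g ^ m) = aeval (ω ^ m) p}
  zero_mem' _ := ⟨0, by simp⟩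
  add_mem' {a b} ha hb g := by
    obtain ⟨p, hp⟩ := ha g
    obtain ⟨q, hq⟩ := hb g
    exact ⟨p + q, fun m => by simp [hp, hq]⟩
  smul_mem' c a ha g := by
    obtain ⟨p, hp⟩ := ha g
    exact ⟨c • p, fun m => by simp [hp]⟩

variable {G : Type*} [Group G] [Finite G] {ω : L}

theorem character_mem_cyclotomicFunctions [IsAlgClosed L] {V : Type*} [AddCommGroup V] [Module L V]
    [FiniteDimensional L V] (hω : IsPrimitiveRoot ω (Nat.card G)) (ρ : Representation L G V) :
    ρ.character ∈ cyclotomicFunctions G ω := by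
  intro g
  obtain ⟨p, hp⟩ := exists_polynomial_trace_pow_eq_aeval (T := ρ g) hω
    (by rw [← map_pow, pow_card_eq_one', map_one])
  exact ⟨p, fun m => by rw [Representation.character, map_pow, hp]⟩

theorem apply_pow_eq_of_mem_cyclotomicFunctions (hω : IsPrimitiveRoot ω (Nat.card G))
    {f : G → L} (hf : f ∈ cyclotomicFunctions G ω) {g : G} {q : ℚ} (hq : f g = q) {m : ℕ}
    (hm : m.Coprime (Nat.card G)) : f (g ^ m) = f g := by
  obtain ⟨p, hp⟩ := hf g
  have hval : aeval ω p = (q : L) := by simpa [hq] using (hp 1).symm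
  rw [hp, hq, aeval_pow_eq_of_aeval_eq_rat hω hm hval]

theorem character_inv_eq_conj {V : Type*} [AddCommGroup V] [Module ℂ V] [FiniteDimensional ℂ V]
    (ρ : Representation ℂ G V) (g : G) : ρ.character g⁻¹ = (starRingEnd ℂ) (ρ.character g) := by
  obtain ⟨ω, hω⟩ := HasEnoughRootsOfUnity.exists_primitiveRoot ℂ (Nat.card G)
  obtain ⟨p, hp⟩ := character_mem_cyclotomicFunctions hω ρ g
  have hg : g ^ (Nat.card G - 1) = g⁻¹ :=
    eq_inv_of_mul_eq_one_left (by rw [pow_sub_one_mul Nat.card_pos.ne', pow_card_eq_one'])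
  have hconj : ω ^ (Nat.card G - 1) = (starRingEnd ℂ) ω := by
    rw [← Complex.inv_eq_conj (hω.norm'_eq_one Nat.card_pos.ne')]
    exact eq_inv_of_mul_eq_one_left (by rw [pow_sub_one_mul Nat.card_pos.ne', hω.pow_eq_one])
  calc ρ.character g⁻¹ = aeval ((starRingEnd ℂ) ω) p := by rw [← hg, hp, hconj]
    _ = (starRingEnd ℂ) (aeval ω p) :=
      aeval_algHom_apply ((Complex.conjAe : ℂ →ₐ[ℝ] ℂ).restrictScalars ℚ) ω p
    _ = (starRingEnd ℂ) (ρ.character g) := by rw [← pow_one ω, ← hp 1, pow_one]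

end CyclotomicFunctions

section SemisimpleRings

theorem eq_zero_of_forall_isSimpleModule_mul_eq_zero {R : Type*} [Ring R] [IsSemisimpleRing R]
    {z : R} (hz : ∀ S : Ideal R, IsSimpleModule R S → ∀ s ∈ S, z * s = 0) : z = 0 := by
  have htop : (1 : R) ∈ sSup {S : Ideal R | IsSimpleModule R S} := by
    rw [IsSemisimpleModule.sSup_simples_eq_top]
    exact Submodule.mem_top
  rw [sSup_eq_iSup'] at htop
  have hmul : ∀ r ∈ ⨆ S : {S : Ideal R | IsSimpleModule R S}, (S : Ideal R), z * r = 0 :=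
    fun r hr => Submodule.iSup_induction _ (motive := fun r => z * r = 0) hr
      (fun S s hs => hz S S.2 s hs) (mul_zero z) fun r s hr hs => by rw [mul_add, hr, hs, add_zero]
  simpa using hmul 1 htop

variable {k A S : Type*} [Field k] [Ring A] [Algebra k A] [AddCommGroup S] [Module k S]
  [Module A S] [IsScalarTower k A S] [FiniteDimensional k S] [IsSimpleModule A S] [IsAlgClosed k]
  {z : A}

theorem exists_lsmul_eq_smul_one_of_mem_center (hz : z ∈ Subalgebra.center k A) :
    ∃ c : k, Algebra.lsmul k k S z = c • (1 : Module.End k S) := by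
  let Z : Module.End A S :=
    { toFun := fun s => z • s
      map_add' := smul_add z
      map_smul' := fun a s => by
        rw [RingHom.id_apply, ← mul_smul, ← mul_smul, Subalgebra.mem_center_iff.1 hz] }
  obtain ⟨c, hc⟩ :=
    (IsSimpleModule.algebraMap_end_bijective_of_isAlgClosed (A := A) (V := S) k).2 Z
  exact ⟨c, LinearMap.ext fun s => (LinearMap.congr_fun hc s).symm⟩

theorem smul_eq_zero_of_mem_center_of_trace_eq_zero [CharZero k]
    (hz : z ∈ Subalgebra.center k A) (htr : LinearMap.trace k S (Algebra.lsmul k k S z) = 0)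
    (s : S) : z • s = 0 := by
  obtain ⟨c, hc⟩ := exists_lsmul_eq_smul_one_of_mem_center (S := S) hz
  have : Nontrivial S := IsSimpleModule.nontrivial A S
  have hc0 : c = 0 := by
    rw [hc, map_smul, LinearMap.trace_one, smul_eq_mul] at htr
    exact (mul_eq_zero.1 htr).resolve_right (Nat.cast_ne_zero.2 Module.finrank_pos.ne')
  simpa [hc0] using LinearMap.congr_fun hc s

end SemisimpleRings

section GroupAlgebra

open scoped MonoidAlgebra

variable {k G : Type*} [Group G] [Fintype G]

/-- The element `∑ g, f g • g⁻¹` of the group algebra attached to a function `f` on the group. On a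
module affording the character `χ` it acts with trace `∑ g, f g * χ g⁻¹`. -/
noncomputable def groupAlgebraElement [Semiring k] (f : G → k) : k[G] :=
  ∑ g, MonoidAlgebra.single g⁻¹ (f g)

theorem coeff_groupAlgebraElement [Semiring k] (f : G → k) (g : G) :
    (groupAlgebraElement f).coeff g⁻¹ = f g := by
  classical
  simp [groupAlgebraElement, MonoidAlgebra.coeff_sum, Finsupp.single_apply]

theorem groupAlgebraElement_mem_center [CommSemiring k] {f : G → k}
    (hf : ∀ g h, f (h * g * h⁻¹) = f g) : groupAlgebraElement f ∈ Subalgebra.center k k[G] := by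
  rw [Subalgebra.mem_center_iff]
  intro r
  induction r using MonoidAlgebra.induction_linear with
  | zero => simp
  | add r s hr hs => rw [mul_add, add_mul, hr, hs]
  | single g c =>
    simp only [groupAlgebraElement, Finset.sum_mul, Finset.mul_sum,
      MonoidAlgebra.single_mul_single]
    refine Fintype.sum_equiv (MulAut.conj g).toEquiv _ _ fun x => ?_
    simp only [MulEquiv.toEquiv_eq_coe, EquivLike.coe_coe, MulAut.conj_apply, hf, mul_comm c]
    group

theorem trace_lsmul_groupAlgebraElement [Field k] (f : G → k) (S : Type*) [AddCommGroup S]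
    [Module k S] [Module k[G] S] [IsScalarTower k k[G] S] :
    LinearMap.trace k S (Algebra.lsmul k k S (groupAlgebraElement f)) =
      ∑ g, f g * (Representation.ofModule' (k := k) (G := G) S).character g⁻¹ := by
  rw [groupAlgebraElement, map_sum, map_sum]
  refine Finset.sum_congr rfl fun g _ => ?_
  rw [show MonoidAlgebra.single g⁻¹ (f g) = f g • MonoidAlgebra.single g⁻¹ (1 : k) by simp,
    map_smul, map_smul, smul_eq_mul]
  rfl

end GroupAlgebra

section IrreducibleCharacters

open scoped MonoidAlgebra

theorem isIrreducible_of_equiv {k G V W : Type*} [Monoid G] [Field k] [AddCommGroup V] [Module k V]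
    [AddCommGroup W] [Module k W] {ρ : Representation k G V} {σ : Representation k G W}
    (e : σ.Equiv ρ) [ρ.IsIrreducible] : σ.IsIrreducible :=
  (Representation.irreducible_iff_isSimpleModule_asModule σ).2 <| IsSimpleModule.congr <|
    LinearEquiv.ofBijective (Representation.IntertwiningMap.equivLinearMapAsModule σ ρ
      e.toIntertwiningMap) e.toLinearEquiv.bijective

theorem isIrreducible_ofModule' {k G S : Type*} [Monoid G] [Field k] [AddCommGroup S] [Module k S]
    [Module k[G] S] [IsScalarTower k k[G] S] [IsSimpleModule k[G] S] :
    (Representation.ofModule' (k := k) (G := G) S).IsIrreducible := by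
  set ρ := Representation.ofModule' (k := k) (G := G) S
  have hlsmul : ρ.asAlgebraHom = Algebra.lsmul k k S :=
    (MonoidAlgebra.lift k _ G).apply_symm_apply _
  let e : ρ.asModule ≃ₗ[k[G]] S :=
    { ρ.asModuleEquiv with
      map_smul' := fun r v => by
        change ρ.asModuleEquiv (r • v) = r • ρ.asModuleEquiv v
        rw [Representation.asModuleEquiv_map_smul, hlsmul, Algebra.lsmul_coe] }
  exact (Representation.irreducible_iff_isSimpleModule_asModule ρ).2 (IsSimpleModule.congr e)

variable {G : Type*} [Group G]

theorem character_mem_irrChars {V : Type*} [AddCommGroup V] [Module ℂ V] [FiniteDimensional ℂ V]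
    (ρ : Representation ℂ G V) [ρ.IsIrreducible] : ρ.character ∈ irrChars G := by
  let b := (Module.finBasis ℂ V).equivFun
  let σ : Representation ℂ G (Fin (Module.finrank ℂ V) → ℂ) :=
    (b.conjAlgEquiv ℂ : _ →* Module.End ℂ (Fin (Module.finrank ℂ V) → ℂ)).comp ρ
  let e : ρ.Equiv σ := Representation.Equiv.mk b fun g => by ext v; simp [σ]
  exact ⟨_, inferInstance, inferInstance, inferInstance, σ, isIrreducible_of_equiv e.symm,
    Representation.char_iso e⟩

theorem apply_conj_of_mem_irrChars {χ : G → ℂ} (hχ : χ ∈ irrChars G) (g h : G) :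
    χ (h * g * h⁻¹) = χ g := by
  obtain ⟨V, _, _, _, ρ, -, rfl⟩ := hχ
  exact Representation.char_conj ρ g h

variable [Finite G]

theorem cfInner_eq_sum [Fintype G] (φ ψ : G → ℂ) :
    cfInner φ ψ = (Nat.card G : ℂ)⁻¹ * ∑ g, φ g * starRingEnd ℂ (ψ g) := by
  rw [cfInner, finsum_eq_sum_of_fintype]

theorem conj_cfInner (φ ψ : G → ℂ) : starRingEnd ℂ (cfInner φ ψ) = cfInner ψ φ := by
  have := Fintype.ofFinite G
  simp [cfInner_eq_sum, mul_comm (ψ _)]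

theorem groupAlgebraElement_smul_eq_zero [Fintype G] {S : Type*} [AddCommGroup S] [Module ℂ S]
    [Module ℂ[G] S] [IsScalarTower ℂ ℂ[G] S] [FiniteDimensional ℂ S] [IsSimpleModule ℂ[G] S]
    {f : G → ℂ} (hf : ∀ g h, f (h * g * h⁻¹) = f g) (h0 : ∀ χ ∈ irrChars G, cfInner f χ = 0)
    (s : S) : groupAlgebraElement f • s = 0 := by
  have : (Representation.ofModule' (k := ℂ) (G := G) S).IsIrreducible := isIrreducible_ofModule'
  have hcard : (Nat.card G : ℂ) ≠ 0 := Nat.cast_ne_zero.2 Nat.card_pos.ne'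
  have htrace : LinearMap.trace ℂ S (Algebra.lsmul ℂ ℂ S (groupAlgebraElement f)) = 0 := by
    have h := h0 _ (character_mem_irrChars (Representation.ofModule' (k := ℂ) (G := G) S))
    rw [cfInner_eq_sum, mul_eq_zero_iff_left (inv_ne_zero hcard)] at h
    simp only [trace_lsmul_groupAlgebraElement, character_inv_eq_conj]
    exact h
  exact smul_eq_zero_of_mem_center_of_trace_eq_zero (k := ℂ) (A := ℂ[G]) (S := S)
    (groupAlgebraElement_mem_center hf) htrace s

theorem eq_zero_of_forall_cfInner_eq_zero {f : G → ℂ} (hf : ∀ g h, f (h * g * h⁻¹) = f g)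
    (h0 : ∀ χ ∈ irrChars G, cfInner f χ = 0) : f = 0 := by
  have := Fintype.ofFinite G
  have : NeZero (Nat.card G : ℂ) := ⟨Nat.cast_ne_zero.2 Nat.card_pos.ne'⟩
  have hz : groupAlgebraElement f = 0 := by
    refine eq_zero_of_forall_isSimpleModule_mul_eq_zero fun S _ s hs => ?_
    have : FiniteDimensional ℂ S :=
      Module.Finite.of_injective (S.subtype.restrictScalars ℂ) S.subtype_injective
    have hsmul := groupAlgebraElement_smul_eq_zero hf h0 (⟨s, hs⟩ : S)
    exact congrArg Subtype.val hsmul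
  funext g
  rw [← coeff_groupAlgebraElement f g, hz]
  rfl

/-- The `ℂ`-linear functional `φ ↦ ⟨φ, ψ⟩`, used to move `cfInner` through finite sums. -/
noncomputable def cfInnerLeft (ψ : G → ℂ) : (G → ℂ) →ₗ[ℂ] ℂ where
  toFun φ := cfInner φ ψ
  map_add' φ φ' := by
    have := Fintype.ofFinite G
    simp [cfInner_eq_sum, add_mul, Finset.sum_add_distrib, mul_add]
  map_smul' c φ := by
    have := Fintype.ofFinite G
    simp [cfInner_eq_sum, mul_assoc, Finset.mul_sum, mul_left_comm c]

theorem cfInnerLeft_apply (φ ψ : G → ℂ) : cfInnerLeft ψ φ = cfInner φ ψ := rfl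

open scoped Classical in
theorem cfInner_character {V W : Type*} [AddCommGroup V] [Module ℂ V] [FiniteDimensional ℂ V]
    [AddCommGroup W] [Module ℂ W] [FiniteDimensional ℂ W] (ρ : Representation ℂ G V)
    (σ : Representation ℂ G W) [ρ.IsIrreducible] [σ.IsIrreducible] :
    cfInner ρ.character σ.character = if Nonempty (σ.Equiv ρ) then 1 else 0 := by
  have := Fintype.ofFinite G
  have := invertibleOfNonzero (Nat.cast_ne_zero.2 Nat.card_pos.ne' : (Nat.card G : ℂ) ≠ 0)
  simp only [cfInner_eq_sum, ← character_inv_eq_conj, Representation.char_orthonormal]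

open scoped Classical in
theorem cfInner_of_mem_irrChars {χ ψ : G → ℂ} (hχ : χ ∈ irrChars G) (hψ : ψ ∈ irrChars G) :
    cfInner χ ψ = if χ = ψ then 1 else 0 := by
  obtain ⟨V, _, _, _, ρ, hρ, rfl⟩ := hχ
  obtain ⟨W, _, _, _, σ, hσ, rfl⟩ := hψ
  split_ifs with h
  · rw [← h, cfInner_character, if_pos ⟨Representation.Equiv.refl ρ⟩]
  · rw [cfInner_character, if_neg fun ⟨e⟩ => h (Representation.char_iso e).symm]

theorem linearIndependent_irrChars :
    LinearIndependent ℂ (fun χ : irrChars G => (χ : G → ℂ)) := by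
  classical
  refine linearIndependent_iff'.2 fun s c hc χ hχ => ?_
  have h := congrArg (cfInnerLeft (χ : G → ℂ)) hc
  rw [map_zero] at h
  simpa [cfInnerLeft_apply, cfInner_of_mem_irrChars (Subtype.prop _) χ.2, Subtype.coe_inj, hχ]
    using h

theorem irrChars_finite : (irrChars G).Finite :=
  have := linearIndependent_irrChars (G := G).finite
  Set.toFinite _

theorem eq_sum_cfInner_smul {f : G → ℂ} (hf : ∀ g h, f (h * g * h⁻¹) = f g) :
    f = ∑ χ ∈ (irrChars_finite (G := G)).toFinset, cfInner f χ • χ := by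
  classical
  refine sub_eq_zero.1 (eq_zero_of_forall_cfInner_eq_zero (fun g h => ?_) fun ψ hψ => ?_)
  · simp only [Pi.sub_apply, Finset.sum_apply, Pi.smul_apply, hf]
    refine congrArg _ (Finset.sum_congr rfl fun χ hχ => ?_)
    rw [apply_conj_of_mem_irrChars ((Set.Finite.mem_toFinset _).1 hχ)]
  · have hsum : ∀ χ ∈ (irrChars_finite (G := G)).toFinset,
        cfInnerLeft ψ (cfInner f χ • χ) = if χ = ψ then cfInner f ψ else 0 := by
      intro χ hχ
      rw [map_smul, cfInnerLeft_apply,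
        cfInner_of_mem_irrChars ((Set.Finite.mem_toFinset _).1 hχ) hψ]
      split_ifs with h <;> simp [h]
    rw [← cfInnerLeft_apply, map_sub, map_sum, Finset.sum_congr rfl hsum, Finset.sum_ite_eq',
      if_pos ((Set.Finite.mem_toFinset _).2 hψ), cfInnerLeft_apply, sub_self]

end IrreducibleCharacters

section CyclicShift

open Matrix

theorem isIntegral_matrix_trace {R K I : Type*} [CommRing R] [Field K] [Algebra R K]
    [IsAlgClosed K] [Fintype I] [DecidableEq I] {Q : Matrix I I K} (hQ : IsIntegral R Q) :
    IsIntegral R Q.trace := by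
  obtain ⟨p, hp, hpQ⟩ := hQ
  rw [trace_eq_sum_roots_charpoly]
  refine IsIntegral.multiset_sum fun μ hμ => ⟨p, hp, ?_⟩
  have hμ : Module.End.HasEigenvalue (toLin' Q) μ := by
    rw [Module.End.hasEigenvalue_iff_isRoot_charpoly, charpoly_toLin']
    exact Polynomial.isRoot_of_mem_roots hμ
  obtain ⟨v, hv⟩ := hμ.exists_hasEigenvector
  have hpv : Polynomial.aeval (toLin' Q) (p.map (algebraMap R K)) = 0 := by
    rw [← Polynomial.aeval_def] at hpQ
    have h := congrArg (toLinAlgEquiv' (R := K)) hpQ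
    rw [map_zero, ← Polynomial.aeval_map_algebraMap K, ← Polynomial.aeval_algHom_apply] at h
    exact h
  have h := Module.End.aeval_apply_of_hasEigenvector (p := p.map (algebraMap R K)) hv
  rw [hpv, LinearMap.zero_apply, eq_comm, smul_eq_zero_iff_left hv.2] at h
  rwa [Polynomial.eval_map] at h

theorem isIntegral_trace_mul_of_isIdempotentElem {K I : Type*} [Field K] [IsAlgClosed K]
    [Fintype I] [DecidableEq I] {P T : Matrix I I K} (hP : IsIdempotentElem P)
    (hPT : Commute P T) {N : ℕ} (hN : 0 < N) (hT : T ^ N = 1) : IsIntegral ℤ (P * T).trace := by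
  have hpow : (P * T) ^ (N + 1) = P * T := by
    rw [hPT.mul_pow, hP.pow_succ_eq, pow_succ, hT, one_mul]
  refine isIntegral_matrix_trace ⟨.X ^ (N + 1) - .X, ?_, ?_⟩
  · exact Polynomial.monic_X_pow_sub <| by
      rw [Polynomial.degree_X]
      exact_mod_cast Nat.succ_lt_succ hN
  · simp [hpow]

variable {R I κ : Type*} [CommSemiring R] [Fintype κ]

/-- The matrix of the tensor product of the endomorphisms with matrices `A k`; the tensors of basis
vectors are indexed by functions `κ → I`. -/
def tensorMatrix (A : κ → Matrix I I R) : Matrix (κ → I) (κ → I) R :=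
  of fun f g => ∏ k, A k (f k) (g k)

theorem tensorMatrix_mul [Fintype I] [DecidableEq κ] (A B : κ → Matrix I I R) :
    tensorMatrix A * tensorMatrix B = tensorMatrix fun k => A k * B k := by
  ext f g
  simp only [tensorMatrix, mul_apply, of_apply, Finset.prod_univ_sum, Fintype.piFinset_univ,
    Finset.prod_mul_distrib]

theorem tensorMatrix_eq_zero {A : κ → Matrix I I R} {k : κ} (h : A k = 0) :
    tensorMatrix A = 0 := by
  ext f g
  exact Finset.prod_eq_zero (Finset.mem_univ k) (by rw [h, Matrix.zero_apply])

variable [DecidableEq I] [DecidableEq κ]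

/-- The matrix of the operator on a tensor power that permutes the tensor factors by `σ`. -/
def tensorPerm (R I : Type*) [CommSemiring R] [DecidableEq I] (σ : Equiv.Perm κ) :
    Matrix (κ → I) (κ → I) R :=
  Equiv.Perm.permMatrix R (σ.arrowCongr (Equiv.refl I))

variable [Fintype I]

theorem tensorMatrix_mul_tensorPerm_apply (A : κ → Matrix I I R) (σ : Equiv.Perm κ)
    (f g : κ → I) :
    (tensorMatrix A * tensorPerm R I σ) f g = ∏ k, A k (f k) (g (σ k)) := by
  rw [tensorPerm, Equiv.Perm.permMatrix, PEquiv.mul_toMatrix_toPEquiv]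
  rfl

theorem tensorPerm_mul_tensorMatrix (A : κ → Matrix I I R) (σ : Equiv.Perm κ) :
    tensorPerm R I σ * tensorMatrix A = tensorMatrix (A ∘ σ) * tensorPerm R I σ := by
  ext f g
  rw [tensorMatrix_mul_tensorPerm_apply, tensorPerm, Equiv.Perm.permMatrix,
    PEquiv.toMatrix_toPEquiv_mul]
  refine (Equiv.prod_comp σ _).symm.trans (Finset.prod_congr rfl fun k _ => ?_)
  simp

theorem tensorPerm_pow (σ : Equiv.Perm κ) (k : ℕ) :
    tensorPerm R I σ ^ k = tensorPerm R I (σ ^ k) := by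
  induction k with
  | zero => exact permMatrix_one.symm
  | succ k ih =>
    rw [pow_succ, ih, pow_succ']
    exact (permMatrix_mul (σ := σ.arrowCongr (Equiv.refl I))
      (τ := (σ ^ k).arrowCongr (Equiv.refl I))).symm

theorem list_prod_ofFn_apply {m : ℕ} (A : Fin (m + 1) → Matrix I I R) (i j : I) :
    (List.ofFn A).prod i j = ∑ f : Fin m → I, ∏ k,
      A k ((Fin.cons i f : Fin (m + 1) → I) k) ((Fin.snoc f j : Fin (m + 1) → I) k) := by
  induction m generalizing i with
  | zero => simp [Fin.snoc]
  | succ m ih =>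
    rw [List.ofFn_succ, List.prod_cons, mul_apply]
    simp only [ih, Finset.mul_sum]
    rw [← Fintype.sum_prod_type', ← (Fin.consEquiv fun _ => I).sum_comp]
    refine Finset.sum_congr rfl fun p _ => ?_
    have hsnoc : (Fin.snoc (Fin.consEquiv (fun _ => I) p) j : Fin (m + 2) → I) =
        Fin.cons p.1 (Fin.snoc p.2 j : Fin (m + 1) → I) :=
      (Fin.cons_snoc_eq_snoc_cons (β := I) p.1 p.2 j).symm
    rw [hsnoc, Fin.prod_univ_succ (n := m + 1)]
    rfl

theorem trace_tensorMatrix_mul_tensorPerm_finRotate {m : ℕ} (A : Fin (m + 1) → Matrix I I R) :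
    (tensorMatrix A * tensorPerm R I (finRotate (m + 1))).trace = (List.ofFn A).prod.trace := by
  simp only [trace, diag_apply, tensorMatrix_mul_tensorPerm_apply, list_prod_ofFn_apply]
  rw [← Fintype.sum_prod_type', ← (Fin.consEquiv fun _ => I).sum_comp]
  refine Finset.sum_congr rfl fun p _ => ?_
  rw [Fin.snoc_eq_cons_rotate]
  rfl

theorem list_prod_ofFn_comp_finRotate_eq_one_iff {G : Type*} [Group G] {m : ℕ}
    (a : Fin (m + 1) → G) :
    (List.ofFn (a ∘ finRotate (m + 1))).prod = 1 ↔ (List.ofFn a).prod = 1 := by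
  have hcomp : a ∘ finRotate (m + 1) = (Fin.snoc (Fin.tail a) (a 0) : Fin (m + 1) → G) := by
    rw [Fin.snoc_eq_cons_rotate, Fin.cons_self_tail]
    rfl
  have hofFn : List.ofFn (Fin.snoc (Fin.tail a) (a 0) : Fin (m + 1) → G) =
      List.ofFn (Fin.tail a) ++ [a 0] := by
    rw [List.ofFn_succ']
    simp
  rw [hcomp, hofFn, List.ofFn_succ (f := a), List.prod_append, List.prod_singleton,
    List.prod_cons, mul_eq_one_iff_eq_inv, eq_comm, inv_eq_iff_mul_eq_one]
  rfl

end CyclicShift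

section Integrality

open Matrix

namespace DrinfeldDouble

variable {G : Type*} [Group G] [Fintype G] [DecidableEq G]

theorem sweedlerPower_zero_e (g h : G) :
    sweedlerPower 0 (e g h) = if g = 1 then (1 : DrinfeldDouble G) else 0 := by
  rw [sweedlerPower, pow_zero, LinearMap.convOne_def]
  simp only [LinearMap.comp_apply, counit_e]
  split_ifs <;> simp

theorem sweedlerPower_succ_e (n : ℕ) (g h : G) :
    sweedlerPower (n + 1) (e g h) =
      ∑ a, (e a h * sweedlerPower n (e (a⁻¹ * g) h) : DrinfeldDouble G) := by
  rw [sweedlerPower, pow_succ', LinearMap.convMul_def]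
  simp only [LinearMap.comp_apply, comul_e, map_sum, TensorProduct.map_tmul,
    LinearMap.mul'_apply]
  rfl

theorem sweedlerPower_e_eq_sum_list_prod (n : ℕ) (g h : G) :
    sweedlerPower n (e g h) = ∑ a : Fin n → G,
      if (List.ofFn a).prod = g then (List.ofFn fun k => e (a k) h : List (DrinfeldDouble G)).prod
        else 0 := by
  induction n generalizing g with
  | zero => simp [sweedlerPower_zero_e, eq_comm]
  | succ n ih =>
    rw [sweedlerPower_succ_e]
    simp only [ih, Finset.mul_sum]
    rw [← Fintype.sum_prod_type', ← (Fin.consEquiv fun _ => G).sum_comp]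
    refine Finset.sum_congr rfl fun p _ => ?_
    have hprod : (List.ofFn (Fin.consEquiv (fun _ => G) p)).prod = g ↔
        (List.ofFn p.2).prod = p.1⁻¹ * g := by
      rw [List.ofFn_succ, List.prod_cons, eq_inv_mul_iff_mul_eq]
      rfl
    rw [mul_ite, mul_zero]
    refine if_congr hprod.symm ?_ rfl
    rw [List.ofFn_succ, List.prod_cons]
    rfl

theorem sweedlerPower_e (n : ℕ) (g h : G) :
    sweedlerPower n (e g h) = ∑ a : G,
      if (a * h⁻¹) ^ n * h ^ n = g then (e a (h ^ n) : DrinfeldDouble G) else 0 := by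
  induction n generalizing g with
  | zero =>
    rw [sweedlerPower_zero_e, one_def]
    simp only [pow_zero, mul_one, eq_comm (a := (1 : G))]
    split_ifs <;> simp
  | succ n ih =>
    rw [sweedlerPower_succ_e]
    refine Finset.sum_congr rfl fun b _ => ?_
    rw [ih, Finset.mul_sum, Finset.sum_eq_single (h⁻¹ * b * h)]
    · have hpow : (h⁻¹ * b * h * h⁻¹) ^ n * h ^ n = b⁻¹ * g ↔
          (b * h⁻¹) ^ (n + 1) * h ^ (n + 1) = g := by
        have hconj : h⁻¹ * b * h * h⁻¹ = h⁻¹ * (b * h⁻¹) * h⁻¹⁻¹ := by group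
        rw [eq_inv_mul_iff_mul_eq, hconj, conj_pow, pow_succ', pow_succ']
        simp only [inv_inv, mul_assoc]
      rw [mul_ite, mul_zero]
      refine if_congr hpow ?_ rfl
      rw [e_mul_e, if_pos (by group), pow_succ']
    · intro a _ ha
      have hne : b ≠ h * a * h⁻¹ := by
        rintro rfl
        exact ha (by group)
      rw [mul_ite, mul_zero, e_mul_e, if_neg hne, ite_self]
    · simp

theorem sum_e_one_mul (x : DrinfeldDouble G) :
    (∑ h, e 1 h) * x = Coalgebra.counit (R := ℂ) x • ∑ h, (e 1 h : DrinfeldDouble G) := by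
  induction x using induction with
  | h0 => simp
  | hadd x x' hx hx' => rw [mul_add, hx, hx', map_add, add_smul]
  | hsmul c x hx => rw [mul_smul_comm, hx, map_smul, smul_assoc]
  | he a k =>
    have ha (h : G) : 1 = h * a * h⁻¹ ↔ a = 1 := by rw [eq_comm, conj_eq_one_iff]
    simp only [Finset.sum_mul, counit_e, e_mul_e, ha]
    split_ifs
    · rw [one_smul]
      exact Equiv.sum_comp (Equiv.mulRight k) (e 1)
    · simp

theorem eq_of_isNormalizedIntegral {Λ : DrinfeldDouble G} (hΛ : IsNormalizedIntegral Λ) :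
    Λ = (Fintype.card G : ℂ)⁻¹ • ∑ h, e 1 h := by
  have hmul := hΛ.1 ((Fintype.card G : ℂ)⁻¹ • ∑ h, e 1 h)
  rw [smul_mul_assoc, sum_e_one_mul, hΛ.2, one_smul] at hmul
  rw [hmul]
  simp [counit_e]

theorem hopfIndicator_eq_inv_card_mul_sum {V : Type*} [AddCommGroup V] [Module ℂ V]
    {Λ : DrinfeldDouble G} (hΛ : IsNormalizedIntegral Λ) (n : ℕ)
    (ρ : DrinfeldDouble G →ₐ[ℂ] Module.End ℂ V) :
    hopfIndicator Λ n ρ =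
      (Fintype.card G : ℂ)⁻¹ * ∑ h, LinearMap.trace ℂ V (ρ (sweedlerPower n (e 1 h))) := by
  simp only [hopfIndicator, eq_of_isNormalizedIntegral hΛ, sweedlerPower, map_smul, map_sum,
    smul_eq_mul]

variable {I : Type*} [Fintype I] [DecidableEq I] (R : DrinfeldDouble G →ₐ[ℂ] Matrix I I ℂ)

/-- The linear map affording the `n`-th tensor power of the matrix representation `R`, that is,
`R ⊗ ⋯ ⊗ R` applied to the iterated coproduct. -/
noncomputable def tensorPowerMatrix (n : ℕ) :
    DrinfeldDouble G →ₗ[ℂ] Matrix (Fin n → I) (Fin n → I) ℂ :=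
  lin fun g h => ∑ a : Fin n → G,
    if (List.ofFn a).prod = g then tensorMatrix fun k => R (e (a k) h) else 0

theorem tensorPowerMatrix_e (n : ℕ) (g h : G) :
    tensorPowerMatrix R n (e g h) = ∑ a : Fin n → G,
      if (List.ofFn a).prod = g then tensorMatrix fun k => R (e (a k) h) else 0 :=
  lin_e _ g h

theorem tensorMatrix_mul_tensorPowerMatrix_e {n : ℕ} (a : Fin n → G) (h b k : G) :
    (tensorMatrix fun i => R (e (a i) h)) * tensorPowerMatrix R n (e b k) =
      if (List.ofFn a).prod = h * b * h⁻¹ then tensorMatrix fun i => R (e (a i) (h * k))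
        else 0 := by
  rw [tensorPowerMatrix_e, Finset.mul_sum, Finset.sum_eq_single fun i => h⁻¹ * a i * h]
  · have hprod : (List.ofFn fun i => h⁻¹ * a i * h).prod = h⁻¹ * (List.ofFn a).prod * h := by
      simpa [List.map_ofFn, Function.comp_def] using
        (map_list_prod (MulAut.conj h⁻¹) (List.ofFn a)).symm
    have hiff : (List.ofFn fun i => h⁻¹ * a i * h).prod = b ↔
        (List.ofFn a).prod = h * b * h⁻¹ := by
      rw [hprod, eq_mul_inv_iff_mul_eq, mul_assoc, inv_mul_eq_iff_eq_mul]
    rw [mul_ite, mul_zero]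
    refine if_congr hiff ?_ rfl
    rw [tensorMatrix_mul]
    congr 1
    funext i
    rw [← map_mul, e_mul_e, if_pos (by group)]
  · intro c _ hc
    obtain ⟨i, hi⟩ := Function.ne_iff.1 hc
    have hne : a i ≠ h * c i * h⁻¹ := fun hi' => hi (by rw [hi']; group)
    rw [mul_ite, mul_zero, tensorMatrix_mul, tensorMatrix_eq_zero (k := i), ite_self]
    rw [← map_mul, e_mul_e, if_neg hne, map_zero]
  · simp

theorem tensorPowerMatrix_mul (n : ℕ) (x y : DrinfeldDouble G) :
    tensorPowerMatrix R n (x * y) = tensorPowerMatrix R n x * tensorPowerMatrix R n y := by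
  induction x using induction with
  | h0 => simp
  | hadd x x' hx hx' => simp only [add_mul, map_add, hx, hx']
  | hsmul c x hx => simp only [smul_mul_assoc, map_smul, hx]
  | he g h =>
    induction y using induction with
    | h0 => simp
    | hadd y y' hy hy' => simp only [mul_add, map_add, hy, hy']
    | hsmul c y hy => simp only [mul_smul_comm, map_smul, hy]
    | he b k =>
      rw [tensorPowerMatrix_e R n g h, Finset.sum_mul, e_mul_e]
      simp only [ite_mul, zero_mul, tensorMatrix_mul_tensorPowerMatrix_e]
      split_ifs with hg
      · rw [tensorPowerMatrix_e, ← hg]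
        exact Finset.sum_congr rfl fun a _ => (by split_ifs <;> rfl)
      · refine (map_zero _).trans (Finset.sum_eq_zero fun a _ => ?_).symm
        split_ifs with ha ha'
        · exact absurd (ha.symm.trans ha') hg
        all_goals rfl

theorem commute_tensorPowerMatrix_e_one (m : ℕ) (h : G) :
    Commute (tensorPowerMatrix R (m + 1) (e 1 h)) (tensorPerm ℂ I (finRotate (m + 1))) := by
  rw [commute_iff_eq, tensorPowerMatrix_e, Finset.mul_sum, Finset.sum_mul,
    ← ((finRotate (m + 1)).symm.arrowCongr (Equiv.refl G)).sum_comp]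
  refine Finset.sum_congr rfl fun a _ => ?_
  rw [mul_ite, mul_zero, tensorPerm_mul_tensorMatrix, ite_mul, zero_mul]
  exact if_congr (list_prod_ofFn_comp_finRotate_eq_one_iff a) rfl rfl

theorem trace_tensorPowerMatrix_mul_tensorPerm (m : ℕ) (g h : G) :
    (tensorPowerMatrix R (m + 1) (e g h) * tensorPerm ℂ I (finRotate (m + 1))).trace =
      (R (sweedlerPower (m + 1) (e g h))).trace := by
  rw [tensorPowerMatrix_e, sweedlerPower_e_eq_sum_list_prod, Finset.sum_mul, map_sum, trace_sum,
    trace_sum]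
  refine Finset.sum_congr rfl fun a _ => ?_
  split_ifs
  · rw [trace_tensorMatrix_mul_tensorPerm_finRotate, map_list_prod, List.map_ofFn]
    rfl
  · simp

theorem isIntegral_trace_sweedlerPower {Λ : DrinfeldDouble G} (hΛ : IsNormalizedIntegral Λ)
    (m : ℕ) : IsIntegral ℤ (R (sweedlerPower (m + 1) Λ)).trace := by
  have hidem : IsIdempotentElem (tensorPowerMatrix R (m + 1) Λ) := by
    rw [IsIdempotentElem, ← tensorPowerMatrix_mul, hΛ.1, hΛ.2, one_smul]
  have hcomm : Commute (tensorPowerMatrix R (m + 1) Λ) (tensorPerm ℂ I (finRotate (m + 1))) := by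
    rw [eq_of_isNormalizedIntegral hΛ, map_smul, map_sum]
    exact (Commute.sum_left _ _ _ fun h _ => commute_tensorPowerMatrix_e_one R m h).smul_left _
  have htrace : (tensorPowerMatrix R (m + 1) Λ * tensorPerm ℂ I (finRotate (m + 1))).trace =
      (R (sweedlerPower (m + 1) Λ)).trace := by
    simp only [eq_of_isNormalizedIntegral hΛ, map_smul, map_sum, smul_mul_assoc, Finset.sum_mul,
      trace_smul, trace_sum, trace_tensorPowerMatrix_mul_tensorPerm, sweedlerPower]
  rw [← htrace]
  refine isIntegral_trace_mul_of_isIdempotentElem hidem hcomm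
    (orderOf_pos (finRotate (m + 1))) ?_
  rw [tensorPerm_pow, pow_orderOf_eq_one]
  exact permMatrix_one

theorem isIntegral_hopfIndicator {V : Type*} [AddCommGroup V] [Module ℂ V]
    [FiniteDimensional ℂ V] {Λ : DrinfeldDouble G} (hΛ : IsNormalizedIntegral Λ) {n : ℕ}
    (hn : 0 < n) (ρ : DrinfeldDouble G →ₐ[ℂ] Module.End ℂ V) :
    IsIntegral ℤ (hopfIndicator Λ n ρ) := by
  obtain ⟨m, rfl⟩ := Nat.exists_eq_succ_of_ne_zero hn.ne'
  rw [hopfIndicator, LinearMap.trace_eq_matrix_trace ℂ (Module.finBasis ℂ V)]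
  exact isIntegral_trace_sweedlerPower
    ((LinearMap.toMatrixAlgEquiv (Module.finBasis ℂ V)).toAlgHom.comp ρ) hΛ m

end DrinfeldDouble

end Integrality

section Indicators

open scoped MonoidAlgebra

-- A section of the projection to the coinvariants is given by averaging over the group.
theorem trace_coinvariants {k K U : Type*} [Field k] [Group K] [Fintype K]
    [NeZero (Nat.card K : k)] [AddCommGroup U] [Module k U] [FiniteDimensional k U]
    (ρ : Representation k K U) (f : Module.End k U) (F : Module.End k ρ.Coinvariants)
    (h : F ∘ₗ Representation.Coinvariants.mk ρ = Representation.Coinvariants.mk ρ ∘ₗ f) :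
    LinearMap.trace k _ F = (Nat.card K : k)⁻¹ * ∑ c, LinearMap.trace k U (f ∘ₗ ρ c) := by
  let A : Module.End k U := (Nat.card K : k)⁻¹ • ∑ c, ρ c
  have hA (x : K) : A ∘ₗ ρ x = A := by
    change ((Nat.card K : k)⁻¹ • ∑ c, ρ c) * ρ x = _
    simp only [smul_mul_assoc, Finset.sum_mul, ← map_mul]
    exact congrArg _ (Equiv.sum_comp (Equiv.mulRight x) fun c => ρ c)
  let s : ρ.Coinvariants →ₗ[k] U := Representation.Coinvariants.lift ρ A hA
  have hs : Representation.Coinvariants.mk ρ ∘ₗ s = LinearMap.id := by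
    refine Representation.Coinvariants.hom_ext (LinearMap.ext fun x => ?_)
    change Representation.Coinvariants.mk ρ (A x) = Representation.Coinvariants.mk ρ x
    simp only [A, LinearMap.smul_apply, LinearMap.sum_apply, map_smul, map_sum,
      Representation.Coinvariants.mk_self_apply, Finset.sum_const, Finset.card_univ]
    rw [← Nat.cast_smul_eq_nsmul k, ← Nat.card_eq_fintype_card,
      inv_smul_smul₀ (NeZero.ne (Nat.card K : k))]
  have hF : F = Representation.Coinvariants.mk ρ ∘ₗ (f ∘ₗ s) := by
    rw [← LinearMap.comp_assoc, ← h, LinearMap.comp_assoc, hs, LinearMap.comp_id]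
  have hfs : (f ∘ₗ s) ∘ₗ Representation.Coinvariants.mk ρ =
      (Nat.card K : k)⁻¹ • ∑ c, f ∘ₗ ρ c := by
    rw [LinearMap.comp_assoc, Representation.Coinvariants.lift_comp_mk, LinearMap.comp_smul]
    exact congrArg _ (Finset.mul_sum _ _ _)
  rw [hF, LinearMap.trace_comp_comm', hfs, map_smul, map_sum, smul_eq_mul]

theorem trace_monoidAlgebra {R M : Type*} [CommRing R] [Fintype M] (f : R[M] →ₗ[R] R[M]) :
    LinearMap.trace R R[M] f = ∑ x, (f (MonoidAlgebra.single x 1)).coeff x := by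
  classical
  rw [LinearMap.trace_eq_matrix_trace R (MonoidAlgebra.basis M R), Matrix.trace]
  refine Finset.sum_congr rfl fun x _ => ?_
  rw [Matrix.diag_apply, LinearMap.toMatrix_apply, MonoidAlgebra.basis_apply]
  rfl

section

variable {G : Type*} [Group G] (n : ℕ) (u : G)

theorem conj_mem_rootSet_iff (c x h : G) :
    x * h * x⁻¹ ∈ rootSet n u c ↔
      (x⁻¹ * u * x * h⁻¹) ^ n * h ^ n = 1 ∧ c * x * (h ^ n)⁻¹ = x := by
  have hdiv : x * h * x⁻¹ * u⁻¹ = x * (x⁻¹ * u * x * h⁻¹)⁻¹ * x⁻¹ := by group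
  have hroot : c * x * (h ^ n)⁻¹ = x ↔ x * h ^ n * x⁻¹ = c := by
    rw [mul_inv_eq_iff_eq_mul, mul_inv_eq_iff_eq_mul, eq_comm]
  rw [rootSet, Set.mem_ofPred_eq, hdiv, conj_pow, conj_pow, mul_left_inj, mul_right_inj, inv_pow,
    inv_eq_iff_mul_eq_one, hroot]

theorem zetaFun_conj (g h : centralizerOf u) : zetaFun n u (h * g * h⁻¹) = zetaFun n u g := by
  have hu : (h : G)⁻¹ * u * h = u := by
    rw [mul_assoc, inv_mul_eq_iff_eq_mul, Subgroup.mem_centralizer_singleton_iff.mp h.2]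
  have himage : rootSet n u (h * g * h⁻¹ : centralizerOf u) =
      MulAut.conj (h : G) '' rootSet n u g := by
    ext a
    obtain ⟨b, rfl⟩ := (MulAut.conj (h : G)).surjective a
    have hb := conj_mem_rootSet_iff n u g 1 b
    simp only [one_mul, inv_one, mul_one] at hb
    rw [(MulAut.conj (h : G)).injective.mem_set_image, MulAut.conj_apply, conj_mem_rootSet_iff, hu,
      hb]
    simp [mul_assoc]
  rw [zetaFun, zetaFun, himage,
    Set.ncard_image_of_injective _ (MulAut.conj (h : G)).injective]

end

variable {G : Type*} [Group G] [Fintype G] [DecidableEq G]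

theorem trace_degreeFilter_comp (u a c k : G) :
    LinearMap.trace ℂ ℂ[G] ((degreeFilter u a ∘ₗ
      MonoidAlgebra.mapDomainLinearMap ℂ ℂ fun x => x * k⁻¹) ∘ₗ
        Representation.leftRegular ℂ G c) =
      ∑ x, if c * x * k⁻¹ = x ∧ x⁻¹ * u * x = a then 1 else 0 := by
  rw [trace_monoidAlgebra]
  refine Finset.sum_congr rfl fun x _ => ?_
  have hx : ((degreeFilter u a ∘ₗ MonoidAlgebra.mapDomainLinearMap ℂ ℂ fun x => x * k⁻¹) ∘ₗ
        Representation.leftRegular ℂ G c) (MonoidAlgebra.single x 1) =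
      degreeFilter u a (MonoidAlgebra.single (c * x * k⁻¹) 1) := by simp
  rw [hx, degreeFilter_single]
  by_cases hfix : c * x * k⁻¹ = x
  · simp only [hfix, true_and]
    split_ifs <;> simp
  · simp only [hfix, false_and, if_false]
    split_ifs <;> simp [hfix]

variable (u : G) {W : Type*} [AddCommGroup W] [Module ℂ W] [FiniteDimensional ℂ W]
  (η : Representation ℂ (centralizerOf u) W)

theorem trace_doubleRep_e [Fintype (centralizerOf u)] (a k : G) :
    LinearMap.trace ℂ _ (doubleRep u η (DrinfeldDouble.e a k)) =
      (Nat.card (centralizerOf u) : ℂ)⁻¹ * ∑ c : centralizerOf u, ∑ x : G,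
        if (c : G) * x * k⁻¹ = x ∧ x⁻¹ * u * x = a then η.character c else 0 := by
  rw [trace_coinvariants
    (Representation.tprod ((Representation.leftRegular ℂ G).comp (centralizerOf u).subtype) η)
    ((degreeFilter u a ∘ₗ MonoidAlgebra.mapDomainLinearMap ℂ ℂ fun x => x * k⁻¹).rTensor W)]
  · congr 1
    refine Finset.sum_congr rfl fun c _ => ?_
    rw [Representation.tprod_apply, LinearMap.rTensor_comp_map]
    refine (LinearMap.trace_tensorProduct' ((degreeFilter u a ∘ₗ
      MonoidAlgebra.mapDomainLinearMap ℂ ℂ fun x => x * k⁻¹) ∘ₗ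
        Representation.leftRegular ℂ G c) (η c)).trans ?_
    simp only [trace_degreeFilter_comp, Finset.sum_mul, ite_mul, one_mul, zero_mul]
    rfl
  · change (DrinfeldDouble.lin _ (DrinfeldDouble.e a k)) ∘ₗ _ = _
    rw [DrinfeldDouble.lin_e, LinearMap.rTensor_comp]
    rfl

theorem trace_doubleRep_sweedlerPower_e_one [Fintype (centralizerOf u)] (n : ℕ) (h : G) :
    LinearMap.trace ℂ _ (doubleRep u η (sweedlerPower n (DrinfeldDouble.e 1 h))) =
      (Nat.card (centralizerOf u) : ℂ)⁻¹ * ∑ c : centralizerOf u, ∑ x : G,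
        (rootSet n u c).indicator (fun _ => η.character c) (x * h * x⁻¹) := by
  rw [DrinfeldDouble.sweedlerPower_e, map_sum, map_sum]
  have hterm (a : G) : LinearMap.trace ℂ _ (doubleRep u η
      (if (a * h⁻¹) ^ n * h ^ n = 1 then DrinfeldDouble.e a (h ^ n) else 0)) =
      (Nat.card (centralizerOf u) : ℂ)⁻¹ * ∑ c : centralizerOf u, ∑ x : G,
        if x⁻¹ * u * x = a then
          (rootSet n u c).indicator (fun _ => η.character c) (x * h * x⁻¹) else 0 := by
    have hx (c : centralizerOf u) (x : G) (hxa : x⁻¹ * u * x = a) :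
        x * h * x⁻¹ ∈ rootSet n u c ↔
          (a * h⁻¹) ^ n * h ^ n = 1 ∧ (c : G) * x * (h ^ n)⁻¹ = x := by
      rw [conj_mem_rootSet_iff, hxa]
    by_cases ha : (a * h⁻¹) ^ n * h ^ n = 1
    · rw [if_pos ha, trace_doubleRep_e]
      refine congrArg _ (Finset.sum_congr rfl fun c _ => Finset.sum_congr rfl fun x _ => ?_)
      by_cases hxa : x⁻¹ * u * x = a <;> simp [Set.indicator, hxa, hx, ha]
    · rw [if_neg ha, map_zero, map_zero, eq_comm]
      refine mul_eq_zero_of_right _ (Finset.sum_eq_zero fun c _ => Finset.sum_eq_zero fun x _ => ?_)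
      by_cases hxa : x⁻¹ * u * x = a <;> simp [hxa, hx, ha]
  simp only [hterm, ← Finset.mul_sum]
  rw [Finset.sum_comm]
  congr! 2 with c _
  rw [Finset.sum_comm]
  simp

theorem hopfIndicator_doubleRep {Λ : DrinfeldDouble G} (hΛ : IsNormalizedIntegral Λ) (n : ℕ) :
    hopfIndicator Λ n (doubleRep u η) = cfInner η.character (zetaFun n u) := by
  classical
  have hcount (c : centralizerOf u) (x : G) :
      ∑ h, (rootSet n u c).indicator (fun _ => η.character c) (x * h * x⁻¹) =
        η.character c * zetaFun n u c := by
    have hsum := Finset.sum_indicator_subset (fun _ => η.character c)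
      (Finset.subset_univ (rootSet n u c).toFinset)
    rw [Set.coe_toFinset, Finset.sum_const, nsmul_eq_mul, mul_comm,
      ← Set.ncard_eq_toFinset_card'] at hsum
    exact (Equiv.sum_comp (MulAut.conj x).toEquiv _).trans hsum
  rw [DrinfeldDouble.hopfIndicator_eq_inv_card_mul_sum hΛ, cfInner_eq_sum]
  simp only [trace_doubleRep_sweedlerPower_e_one, ← Finset.mul_sum]
  rw [Finset.sum_comm, mul_left_comm]
  congr 1
  rw [Finset.mul_sum]
  refine Finset.sum_congr rfl fun c _ => ?_
  rw [Finset.sum_comm]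
  simp only [hcount, Finset.sum_const, Finset.card_univ, nsmul_eq_mul]
  rw [inv_mul_cancel_left₀ (by simp)]
  simp [zetaFun]

end Indicators

section RationalClassFunctions

variable {G : Type*} [Group G] [Finite G]

theorem exists_modEq_coprime_of_dvd {a b m : ℕ} [NeZero b] (hab : a ∣ b) (hm : m.Coprime a) :
    ∃ k : ℕ, k ≡ m [MOD a] ∧ k.Coprime b := by
  obtain ⟨v, hv⟩ := ZMod.unitsMap_surjective hab (ZMod.unitOfCoprime m hm)
  refine ⟨(v : ZMod b).val, ?_, ZMod.val_coe_unit_coprime v⟩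
  have hcast := congrArg (fun w : (ZMod a)ˣ => (w : ZMod a)) hv
  rw [← ZMod.natCast_eq_natCast_iff]
  simpa [ZMod.unitsMap_def] using hcast

theorem exists_pow_eq_pow_and_coprime_of_mem_subgroup {H : Subgroup G} {g : G} (hg : g ∈ H) {m : ℕ}
    (hm : m.Coprime (Nat.card H)) : ∃ k : ℕ, k.Coprime (Nat.card G) ∧ g ^ k = g ^ m := by
  obtain ⟨k, hkm, hk⟩ := exists_modEq_coprime_of_dvd (Subgroup.card_subgroup_dvd_card H) hm
  exact ⟨k, hk, pow_eq_pow_iff_modEq.2 (hkm.of_dvd (Subgroup.orderOf_dvd_natCard H hg))⟩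

theorem irrChars_subset_cyclotomicFunctions {ω : ℂ} (hω : IsPrimitiveRoot ω (Nat.card G)) :
    irrChars G ⊆ cyclotomicFunctions G ω := by
  rintro _ ⟨W, _, _, _, ρ, -, rfl⟩
  exact character_mem_cyclotomicFunctions hω ρ

theorem virtualChars_le_cyclotomicFunctions {ω : ℂ} (hω : IsPrimitiveRoot ω (Nat.card G)) :
    virtualChars G ≤ (cyclotomicFunctions G ω).toAddSubgroup := by
  rw [virtualChars, AddSubgroup.closure_le]
  exact irrChars_subset_cyclotomicFunctions hω

open Polynomial in
theorem exists_rat_eq_cfInner {f : G → ℂ} (hrat : ∀ g, ∃ q : ℚ, f g = q)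
    (hpow : ∀ g (m : ℕ), m.Coprime (Nat.card G) → f (g ^ m) = f g) {χ : G → ℂ}
    (hχ : χ ∈ irrChars G) : ∃ q : ℚ, cfInner f χ = q := by
  have := Fintype.ofFinite G
  obtain ⟨ω, hω⟩ := HasEnoughRootsOfUnity.exists_primitiveRoot ℂ (Nat.card G)
  choose q hq using hrat
  choose p hp using irrChars_subset_cyclotomicFunctions hω hχ
  let P : ℚ[X] := C (Nat.card G : ℚ)⁻¹ * ∑ g, p g * C (q g)
  have hP (m : ℕ) (hm : m.Coprime (Nat.card G)) : aeval (ω ^ m) P = cfInner χ f := by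
    rw [cfInner_eq_sum, ← Equiv.sum_comp (powCoprime hm.symm)]
    simp only [powCoprime_apply, hpow _ m hm, hp, hq]
    simp [P]
  have hP₁ : aeval ω P = cfInner χ f := by simpa using hP 1 (Nat.coprime_one_left _)
  obtain ⟨r, hr⟩ := exists_rat_of_aeval_pow_eq hω fun m hm => (hP m hm).trans hP₁.symm
  exact ⟨r, by rw [← conj_cfInner, ← hP₁, hr, map_ratCast]⟩

variable {f : G → ℂ}

theorem mem_virtualChars_of_forall_int (hf : ∀ g h, f (h * g * h⁻¹) = f g)
    (hint : ∀ χ ∈ irrChars G, ∃ m : ℤ, cfInner f χ = m) : f ∈ virtualChars G := by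
  rw [eq_sum_cfInner_smul hf]
  refine sum_mem fun χ hχ => ?_
  rw [Set.Finite.mem_toFinset] at hχ
  obtain ⟨m, hm⟩ := hint χ hχ
  rw [hm, Int.cast_smul_eq_zsmul]
  exact zsmul_mem (AddSubgroup.subset_closure hχ) m

theorem mem_cyclotomicFunctions_of_forall_rat {ω : ℂ} (hω : IsPrimitiveRoot ω (Nat.card G))
    (hf : ∀ g h, f (h * g * h⁻¹) = f g) (hrat : ∀ χ ∈ irrChars G, ∃ q : ℚ, cfInner f χ = q) :
    f ∈ cyclotomicFunctions G ω := by
  rw [eq_sum_cfInner_smul hf]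
  refine sum_mem fun χ hχ => ?_
  rw [Set.Finite.mem_toFinset] at hχ
  obtain ⟨q, hq⟩ := hrat χ hχ
  rw [hq, Rat.cast_smul_eq_qsmul]
  exact Submodule.smul_mem _ q (irrChars_subset_cyclotomicFunctions hω hχ)

theorem forall_rationallyConj_iff_forall_pow (hf : ∀ g h, f (h * g * h⁻¹) = f g) :
    (∀ g h, RationallyConj g h → f g = f h) ↔
      ∀ g (m : ℕ), m.Coprime (Nat.card G) → f (g ^ m) = f g := by
  refine ⟨fun h g m hm => (h g _ ⟨m, hm, IsConj.refl _⟩).symm, ?_⟩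
  rintro h g _ ⟨m, hm, hconj⟩
  obtain ⟨c, rfl⟩ := isConj_iff.1 hconj
  rw [hf, h g m hm]

theorem forall_int_cfInner_of_forall_pow (hrat : ∀ g, ∃ q : ℚ, f g = q)
    (hint : ∀ χ ∈ irrChars G, IsIntegral ℤ (cfInner f χ))
    (hpow : ∀ g (m : ℕ), m.Coprime (Nat.card G) → f (g ^ m) = f g) :
    ∀ χ ∈ irrChars G, ∃ m : ℤ, cfInner f χ = m := by
  intro χ hχ
  obtain ⟨q, hq⟩ := exists_rat_eq_cfInner hrat hpow hχ
  have hq_int : IsIntegral ℤ q :=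
    (isIntegral_algebraMap_iff (algebraMap ℚ ℂ).injective).1 (by simpa [hq] using hint χ hχ)
  obtain ⟨m, hm⟩ := IsIntegrallyClosed.isIntegral_iff.1 hq_int
  exact ⟨m, by rw [hq, ← hm]; simp⟩

theorem forall_cyclic_rat_cfInner_iff_forall_pow (hf : ∀ g h, f (h * g * h⁻¹) = f g)
    (hrat : ∀ g, ∃ q : ℚ, f g = q) :
    (∀ H : Subgroup G, IsCyclic H → ∀ χ ∈ irrChars H,
        ∃ q : ℚ, cfInner (fun h : H => f h) χ = q) ↔
      ∀ g (m : ℕ), m.Coprime (Nat.card G) → f (g ^ m) = f g := by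
  constructor
  · intro h g m hm
    obtain ⟨ω, hω⟩ :=
      HasEnoughRootsOfUnity.exists_primitiveRoot ℂ (Nat.card (Subgroup.zpowers g))
    have hmem : (fun x : Subgroup.zpowers g => f x) ∈ cyclotomicFunctions _ ω :=
      mem_cyclotomicFunctions_of_forall_rat hω (fun x y => hf x y) (h _ inferInstance)
    obtain ⟨q, hq⟩ := hrat g
    exact apply_pow_eq_of_mem_cyclotomicFunctions hω hmem (g := ⟨g, Subgroup.mem_zpowers g⟩) hq
      (hm.coprime_dvd_right (Subgroup.card_subgroup_dvd_card _))
  · intro hpow H _ χ hχ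
    refine exists_rat_eq_cfInner (f := fun x : H => f x) (fun x => hrat x) (fun x m hm => ?_) hχ
    obtain ⟨k, hk, hkm⟩ := exists_pow_eq_pow_and_coprime_of_mem_subgroup x.2 hm
    rw [Subgroup.coe_pow, ← hkm, hpow _ k hk]

theorem tfae_of_isIntegral_cfInner (hf : ∀ g h, f (h * g * h⁻¹) = f g)
    (hrat : ∀ g, ∃ q : ℚ, f g = q) (hint : ∀ χ ∈ irrChars G, IsIntegral ℤ (cfInner f χ)) :
    List.TFAE [
      ∀ χ ∈ irrChars G, ∃ m : ℤ, cfInner f χ = m,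
      f ∈ virtualChars G,
      ∀ H : Subgroup G, IsCyclic H → ∀ χ ∈ irrChars H,
        ∃ q : ℚ, cfInner (fun h : H => f h) χ = q,
      ∀ g h, RationallyConj g h → f g = f h] := by
  rw [forall_rationallyConj_iff_forall_pow hf]
  tfae_have 1 → 2 := mem_virtualChars_of_forall_int hf
  tfae_have 2 → 4 := by
    intro hmem g m hm
    obtain ⟨ω, hω⟩ := HasEnoughRootsOfUnity.exists_primitiveRoot ℂ (Nat.card G)
    obtain ⟨q, hq⟩ := hrat g
    exact apply_pow_eq_of_mem_cyclotomicFunctions hω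
      (virtualChars_le_cyclotomicFunctions hω hmem) hq hm
  tfae_have 4 → 1 := forall_int_cfInner_of_forall_pow hrat hint
  tfae_have 3 ↔ 4 := forall_cyclic_rat_cfInner_iff_forall_pow hf hrat
  tfae_finish

end RationalClassFunctions

section ZetaMultiplicities

variable {G : Type*} [Group G] [Fintype G] [DecidableEq G] {u : G} {Λ : DrinfeldDouble G} {n : ℕ}

theorem cfInner_zetaFun_character (hΛ : IsNormalizedIntegral Λ) {W : Type*} [AddCommGroup W]
    [Module ℂ W] [FiniteDimensional ℂ W] (η : Representation ℂ (centralizerOf u) W) :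
    cfInner (zetaFun n u) η.character =
      starRingEnd ℂ (hopfIndicator Λ n (doubleRep u η)) := by
  rw [hopfIndicator_doubleRep u η hΛ, conj_cfInner]

theorem forall_int_hopfIndicator_iff (hΛ : IsNormalizedIntegral Λ) :
    (∀ (W : Type) [AddCommGroup W] [Module ℂ W] [FiniteDimensional ℂ W]
        (η : Representation ℂ (centralizerOf u) W), η.IsIrreducible →
          ∃ m : ℤ, hopfIndicator Λ n (doubleRep u η) = (m : ℂ)) ↔
      ∀ χ ∈ irrChars (centralizerOf u), ∃ m : ℤ, cfInner (zetaFun n u) χ = m := by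
  constructor
  · rintro h _ ⟨W, _, _, _, η, hη, rfl⟩
    obtain ⟨m, hm⟩ := h W η hη
    exact ⟨m, by rw [cfInner_zetaFun_character hΛ, hm, map_intCast]⟩
  · intro h W _ _ _ η hη
    obtain ⟨m, hm⟩ := h _ ⟨W, _, _, ‹_›, η, hη, rfl⟩
    rw [cfInner_zetaFun_character hΛ] at hm
    exact ⟨m, by rw [← Complex.conj_conj (hopfIndicator _ _ _), hm, map_intCast]⟩

end ZetaMultiplicities

theorem isIntegral_cfInner_zetaFun {G : Type*} [Group G] [Finite G] {u : G} {n : ℕ} (hn : 0 < n)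
    {χ : centralizerOf u → ℂ} (hχ : χ ∈ irrChars (centralizerOf u)) :
    IsIntegral ℤ (cfInner (zetaFun n u) χ) := by
  classical
  have := Fintype.ofFinite G
  obtain ⟨W, _, _, _, η, -, rfl⟩ := hχ
  obtain ⟨Λ, hΛ⟩ := DrinfeldDouble.exists_isNormalizedIntegral (G := G)
  rw [cfInner_zetaFun_character hΛ]
  exact (DrinfeldDouble.isIntegral_hopfIndicator hΛ hn (doubleRep u η)).map
    (starRingEnd ℂ).toIntAlgHom

theorem mainTheorem1 {G : Type*} [Group G] [Fintype G] [DecidableEq G]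
    (u : G) (n : ℕ) (hn : 0 < n)
    (Λ : DrinfeldDouble G) (hΛ : IsNormalizedIntegral Λ) :
    List.TFAE [
      ∀ (W : Type) [AddCommGroup W] [Module ℂ W] [FiniteDimensional ℂ W]
        (η : Representation ℂ (centralizerOf u) W), η.IsIrreducible →
          ∃ m : ℤ, hopfIndicator Λ n (doubleRep u η) = (m : ℂ),
      zetaFun n u ∈ virtualChars (centralizerOf u),
      ∀ H : Subgroup (centralizerOf u), IsCyclic H → ∀ χ ∈ irrChars H,
        ∃ q : ℚ, cfInner (fun h : H => zetaFun n u (h : centralizerOf u)) χ = (q : ℂ),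
      ∀ g h : centralizerOf u, RationallyConj g h → zetaFun n u g = zetaFun n u h] := by
  rw [forall_int_hopfIndicator_iff hΛ]
  have hrat (g : centralizerOf u) : ∃ q : ℚ, zetaFun n u g = q :=
    ⟨(rootSet n u g).ncard, by simp [zetaFun]⟩
  exact tfae_of_isIntegral_cfInner (zetaFun_conj n u) hrat fun χ => isIntegral_cfInner_zetaFun hn
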